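/- Fix the canonical inner product on $\mathbb R^n$, with orthonormal basis $X_1,\dots,X_n$. A nilpotent Lie bracket $\mu$ on $\mathbb R^n$ is a *nilsoliton* if the Ricci operator of the corresponding left-invariant metric is $cI+D$ with $c\in\mathbb R$ and $D$ a derivation of $\mu$. Let $\mathfrak p_\mu$ be the space of derivations of $\mu$ that are symmetric. The *rank* of $\mu$ is $\operatorname{rank}(\mu)=\dim\mathfrak a_\mu$, where $\mathfrak a_\mu$ is a maximal abelian subalgebra (i.e. a maximal subspace of pairwise commuting elements) of $\mathfrak p_\mu$. Brackets are written as vectors of 2-forms: a term $c\,\mathbf{ij}$ in the $k$-th coordinate means that $\mu(X_i,X_j)$ has $X_k$-component $c$. Consider the following list. In each line the third entry is a set of matrices, the letters $a,b,c,d,f$ running over $\mathbb R$, and $\operatorname{diag}$ is omitted for diagonal matrices. Abelian: $\mathbb R^n$, $\mu=0$, for $1\le n\le 6$ (called $\eta_3,\lambda_9,\mu_{34}$ for $n=4,5,6$): rank $n$; all diagonal matrices. Dimension 3: - $\mathfrak h_3$: $(0,0,\mathbf{12})$; rank 2; $(a,b,a+b)$. Dimension 4: - $\eta_1$: $(0,0,\mathbf{12},\mathbf{13})$;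 2; $(a,b,a+b,2a+b)$. - $\eta_2$: $(0,0,0,\mathbf{12})$; 3; $(a,b,c,a+b)$. Dimension 5: - $\lambda_1$: $(0,0,\sqrt3\,\mathbf{12},\sqrt4\,\mathbf{13},\sqrt3\,\mathbf{14})$; 2; $(a,b,a+b,2a+b,3a+b)$. - $\lambda_2$: $(0,0,\sqrt3\,\mathbf{12},\sqrt3\,\mathbf{13},\sqrt2\,\mathbf{14}+\sqrt2\,\mathbf{23})$; 1; $a(1,2,3,4,5)$. - $\lambda_3$: $(0,0,0,\sqrt2\,\mathbf{12},\mathbf{23}+\sqrt2\,\mathbf{14})$; 2; $(a,b,2a,a+b,2a+b)$. - $\lambda_4$: $(0,0,0,0,\mathbf{12}+\mathbf{34})$; 3; $(a,b,c,a+b-c,a+b)$. - $\lambda_5$: $(0,0,2\,\mathbf{12},\sqrt3\,\mathbf{13},\sqrt3\,\mathbf{23})$; 2; $(a,b,a+b,2a+b,a+2b)$. - $\lambda_6$: $(0,0,0,\mathbf{12},\mathbf{13})$; 3; $(a,b,c,a+b,a+c)$. - $\lambda_7$: $(0,0,0,0,\mathbf{12})$; 4; $(a,b,c,d,a+b)$.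 - $\lambda_8$: $(0,0,0,\mathbf{12},\mathbf{14})$; 3; $(a,b,c,a+b,2a+b)$. Dimension 6: - $\mu_1$: $(0,0,\sqrt{13}\,\mathbf{12},4\,\mathbf{13},\sqrt{12}\,\mathbf{14}+2\,\mathbf{23},\sqrt{12}\,\mathbf{34}+\sqrt{13}\,\mathbf{52})$; 1; $a(1,2,3,4,5,7)$. - $\mu_2$: $(0,0,\mathbf{12},\sqrt{4/3}\,\mathbf{13},\mathbf{14},\mathbf{34}+\mathbf{52})$; 2; $(a,b,a+b,2a+b,3a+b,3a+2b)$. - $\mu_3$: $(0,0,2\,\mathbf{12},\sqrt6\,\mathbf{13},\sqrt6\,\mathbf{14},2\,\mathbf{15})$; 2; $(a,b,a+b,2a+b,3a+b,4a+b)$. - $\mu_4$: $(0,0,\sqrt{22}\,\mathbf{12},6\,\mathbf{13},\sqrt{22}\,\mathbf{14}+\sqrt{30}\,\mathbf{23},5\,\mathbf{24}+\sqrt{30}\,\mathbf{15})$; 1; $a(1,2,3,4,5,6)$. - $\mu_5$: $(0,0,\sqrt7\,\mathbf{12},\sqrt{15/2}\,\mathbf{13},3\,\mathbf{14},\sqrt{15/2}\,\mathbf{23}+2\,\mathbf{15})$;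 1; $a(1,3,4,5,6,7)$. - $\mu_6$: $(0,0,\mathbf{12},\mathbf{13},\mathbf{23},\mathbf{14})$; 2; $(a,b,a+b,2a+b,a+2b,3a+b)$. - $\mu_7$: $(0,0,2\,\mathbf{12},\sqrt5\,\mathbf{13},\sqrt5\,\mathbf{23},2\,\mathbf{14}-2\,\mathbf{25})$; 2; block diagonal matrices $\operatorname{diag}\left(\begin{bmatrix}a&b\\b&a\end{bmatrix},2a,\begin{bmatrix}3a&b\\b&3a\end{bmatrix},4a\right)$. - $\mu_8$: $(0,0,2\,\mathbf{12},\sqrt5\,\mathbf{13},\sqrt5\,\mathbf{23},2\,\mathbf{14}+2\,\mathbf{25})$; 1; $a(1,1,2,3,3,4)$. - $\mu_9$: $(0,0,0,\sqrt{5/4}\,\mathbf{12},\mathbf{14}-\mathbf{23},\sqrt{5/4}\,\mathbf{15}+\mathbf{34})$; 2; $(a,b,2a,a+b,2a+b,3a+b)$. - $\mu_{10}$: $(0,0,0,\mathbf{12},\sqrt{5/3}\,\mathbf{14},\mathbf{15}+\mathbf{23})$; 2; $(a,b,3a,a+b,2a+b,3a+b)$. - $\mu_{11}$: $(0,0,-\sqrt{25/56}\,\mathbf{12},\sqrt{3/7}\,\mathbf{12},\sqrt{5/28}\,\mathbf{14}-\sqrt{15/14}\,\mathbf{13},\sqrt{3/4}\,\mathbf{15}+\sqrt{7/8}\,\mathbf{24})$;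 1; $a(1,2,3,3,4,5)$. - $\mu_{12}$: $(0,0,0,\sqrt3\,\mathbf{12},\sqrt3\,\mathbf{14},\sqrt2\,\mathbf{15}+\sqrt2\,\mathbf{24})$; 2; $(a,2a,b,3a,4a,5a)$. - $\mu_{13}$: $(0,0,0,\sqrt3\,\mathbf{12},2\,\mathbf{14},\sqrt3\,\mathbf{15})$; 3; $(a,b,c,a+b,2a+b,3a+b)$. - $\mu_{14}$: $(0,0,0,\sqrt3\,\mathbf{12},\sqrt2\,\mathbf{13},\sqrt2\,\mathbf{14}+\sqrt3\,\mathbf{35})$; 2; $(a,b,\frac{a+b}2,a+b,\frac{3a+b}2,2a+b)$. - $\mu_{15}$: $(0,0,0,\mathbf{12},\mathbf{23},\mathbf{14}+\mathbf{35})$; 3; in the reordered basis $X_1,X_3,X_2,X_4,X_5,X_6$: block diagonal matrices $\operatorname{diag}\left(\begin{bmatrix}a&c\\c&a\end{bmatrix},b,\begin{bmatrix}a+b&-c\\-c&a+b\end{bmatrix},2a+b\right)$. - $\mu_{16}$: $(0,0,0,\mathbf{12},\mathbf{23},\mathbf{14}-\mathbf{35})$; 2; $(a,b,a,a+b,a+b,2a+b)$.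 - $\mu_{17}$: $(0,0,0,2\,\mathbf{12},\sqrt3\,\mathbf{14},\sqrt3\,\mathbf{24})$; 3; $(a,b,c,a+b,2a+b,a+2b)$. - $\mu_{18}$: $(0,0,0,\sqrt2\,\mathbf{12},\frac1{\sqrt2}\,\mathbf{13}+\sqrt{3/2}\,\mathbf{42},\sqrt{3/2}\,\mathbf{14}+\frac1{\sqrt2}\,\mathbf{23})$; 1; $a(1,1,2,2,3,3)$. - $\mu_{19}$: $(0,0,0,2\,\mathbf{12},\sqrt3\,\mathbf{14},\mathbf{13}+\sqrt3\,\mathbf{42})$; 2; $(a,b,2b,a+b,2a+b,a+2b)$. - $\mu_{20}$: $(0,0,-\mathbf{12},\sqrt3\,\mathbf{12},2\,\mathbf{14},\mathbf{24}-\sqrt3\,\mathbf{23})$; 2; $(a,b,a+b,a+b,2a+b,a+2b)$. - $\mu_{21}$: $(0,0,0,\sqrt2\,\mathbf{12},\mathbf{13},\sqrt2\,\mathbf{14}+\mathbf{23})$; 2; $(a,b,2a,a+b,3a,2a+b)$. - $\mu_{22}$: $(0,0,0,\sqrt{3/4}\,\mathbf{12},\sqrt{3/4}\,\mathbf{13},\mathbf{24})$;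 3; $(a,b,c,a+b,a+c,a+2b)$. - $\mu_{23}$: $(0,0,0,\sqrt2\,\mathbf{12},\mathbf{13},\sqrt2\,\mathbf{14})$; 3; $(a,b,c,a+b,a+c,2a+b)$. - $\mu_{24}$: $(0,0,0,\mathbf{12},\mathbf{13},\mathbf{23})$; 3; $(a,b,c,a+b,a+c,b+c)$. - $\mu_{25}$: $(0,0,0,0,2\,\mathbf{12},\sqrt3\,\mathbf{15}+\sqrt3\,\mathbf{34})$; 3; $(a,b,c,2a+b-c,a+b,2a+b)$. - $\mu_{26}$: $(0,0,0,0,\mathbf{12},\mathbf{15})$; 4; $(a,b,c,d,a+b,2a+b)$. - $\mu_{27}$: $(0,0,0,0,\sqrt2\,\mathbf{12},\mathbf{14}+\sqrt2\,\mathbf{25})$; 3; $(a,b,c,2b,a+b,a+2b)$. - $\mu_{28}$: $(0,0,0,0,\mathbf{13}+\mathbf{42},\mathbf{14}+\mathbf{23})$; 2; $(a,a,b,b,a+b,a+b)$. - $\mu_{29}$: $(0,0,0,0,\mathbf{12},\mathbf{14}+\mathbf{23})$; 3; $(a,b,c,c-a+b,a+b,b+c)$. - $\mu_{30}$: $(0,0,0,0,\mathbf{12},\mathbf{34})$;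 4; $(a,b,c,d,a+b,c+d)$. - $\mu_{31}$: $(0,0,0,0,\mathbf{12},\mathbf{13})$; 4; $(a,b,c,d,a+b,a+c)$. - $\mu_{32}$: $(0,0,0,0,0,\mathbf{12}+\mathbf{34})$; 4; $(a,b,c,a+b-c,d,a+b)$. - $\mu_{33}$: $(0,0,0,0,0,\mathbf{12})$; 5; $(a,b,c,d,f,a+b)$. Then, for every bracket $\mu$ in the list: $\mu$ is a nilsoliton; the given set of matrices is a maximal abelian subalgebra $\mathfrak a_\mu$ of symmetric derivations of $\mu$; all maximal abelian subalgebras of $\mathfrak p_\mu$ have the same dimension, so that $\operatorname{rank}(\mu)$ is well defined; and $\operatorname{rank}(\mu)$ is the given number. Moreover, within the list, the rank is one exactly for the one-dimensional abelian $\mathbb R^1$ and for $\lambda_2,\mu_1,\mu_4,\mu_5,\mu_8,\mu_{11}$ and $\mu_{18}$. -/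

import Mathlib

namespace Solsoliton

/-- Bilinear maps `ℝⁿ × ℝⁿ → ℝⁿ`. The inner product on `ℝⁿ = Fin n → ℝ` is always the
canonical one (the dot product `⬝ᵥ`). -/
abbrev Bracket (n : ℕ) : Type :=
  (Fin n → ℝ) →ₗ[ℝ] (Fin n → ℝ) →ₗ[ℝ] (Fin n → ℝ)

/-- Bilinear forms on `ℝⁿ`. -/
abbrev BilForm (n : ℕ) : Type := (Fin n → ℝ) →ₗ[ℝ] (Fin n → ℝ) →ₗ[ℝ] ℝ

/-- The canonical basis of `ℝⁿ`. -/
def basisVec {n : ℕ} (i : Fin n) : Fin n → ℝ := Pi.single i 1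

/-! ### Nilpotent Lie brackets -/

/-- The lower central series: `ℝⁿ`, then `[ℝⁿ, ·]` repeatedly. -/
def lowerCentral {n : ℕ} (μ : Bracket n) : ℕ → Submodule ℝ (Fin n → ℝ)
  | 0 => ⊤
  | k + 1 => Submodule.span ℝ {z | ∃ x : Fin n → ℝ, ∃ y ∈ lowerCentral μ k, z = μ x y}

/-- `μ` is a nilpotent Lie bracket on `ℝⁿ`. -/
structure IsNilpotentLie {n : ℕ} (μ : Bracket n) : Prop where
  alternating : ∀ x, μ x x = 0
  jacobi : ∀ x y z, μ x (μ y z) + μ y (μ z x) + μ z (μ x y) = 0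
  nilpotent : ∃ k, lowerCentral μ k = ⊥

/-- `D` is a derivation of `(ℝⁿ, μ)`. -/
def IsDerivation {n : ℕ} (μ : Bracket n) (D : Matrix (Fin n) (Fin n) ℝ) : Prop :=
  ∀ x y, D.mulVec (μ x y) = μ (D.mulVec x) y + μ x (D.mulVec y)

/-! ### Curvature of the left-invariant metric, and nilsolitons -/

/-- The Levi-Civita connection of the left-invariant metric on left-invariant fields, given by
the Koszul formula `2⟨∇_x y, z⟩ = ⟨[x,y],z⟩ - ⟨[y,z],x⟩ + ⟨[z,x],y⟩`. -/
noncomputable def leviCivita {n : ℕ} (μ : Bracket n) (x y : Fin n → ℝ) : Fin n → ℝ := fun k =>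
  (1 / 2) * (dotProduct (μ x y) (basisVec k) - dotProduct (μ y (basisVec k)) x
    + dotProduct (μ (basisVec k) x) y)

/-- The curvature tensor `R(x,y)z = ∇_x ∇_y z - ∇_y ∇_x z - ∇_[x,y] z`. -/
noncomputable def curvature {n : ℕ} (μ : Bracket n) (x y z : Fin n → ℝ) : Fin n → ℝ :=
  leviCivita μ x (leviCivita μ y z) - leviCivita μ y (leviCivita μ x z)
    - leviCivita μ (μ x y) z

/-- The Ricci operator, as the matrix with entries `Ric(e_i, e_j) = tr (z ↦ R(z, e_i) e_j)` in
the canonical orthonormal basis. -/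
noncomputable def ricci {n : ℕ} (μ : Bracket n) : Matrix (Fin n) (Fin n) ℝ :=
  Matrix.of fun i j =>
    ∑ k, dotProduct (curvature μ (basisVec k) (basisVec i) (basisVec j)) (basisVec k)

/-- `μ` is a nilsoliton: a nilpotent Lie bracket whose Ricci operator is `c I + D` with `D` a
derivation. -/
def IsNilsoliton {n : ℕ} (μ : Bracket n) : Prop :=
  IsNilpotentLie μ ∧
    ∃ (c : ℝ) (D : Matrix (Fin n) (Fin n) ℝ), IsDerivation μ D ∧ ricci μ = c • 1 + D

/-! ### Symmetric derivations and the rank -/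

/-- The space `𝔭_μ` of symmetric derivations. -/
def symDer {n : ℕ} (μ : Bracket n) : Submodule ℝ (Matrix (Fin n) (Fin n) ℝ) where
  carrier := {D | D.IsSymm ∧ IsDerivation μ D}
  zero_mem' := ⟨Matrix.isSymm_zero, fun x y => by simp⟩
  add_mem' := by
    rintro A B ⟨hA, hA'⟩ ⟨hB, hB'⟩
    refine ⟨hA.add hB, fun x y => ?_⟩
    simp only [Matrix.add_mulVec, map_add, LinearMap.add_apply, hA' x y, hB' x y]
    abel
  smul_mem' := by
    rintro c A ⟨hA, hA'⟩
    refine ⟨hA.smul c, fun x y => ?_⟩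
    simp only [Matrix.smul_mulVec, map_smul, LinearMap.smul_apply, hA' x y, smul_add]

/-- `𝔞` is an abelian subalgebra of symmetric derivations: a subspace of `𝔭_μ` on which the
commutator vanishes (such a subspace is automatically a Lie subalgebra). -/
def IsAbelianSub {n : ℕ} (μ : Bracket n) (𝔞 : Submodule ℝ (Matrix (Fin n) (Fin n) ℝ)) : Prop :=
  𝔞 ≤ symDer μ ∧ ∀ A ∈ 𝔞, ∀ B ∈ 𝔞, ⁅A, B⁆ = 0

/-- `𝔞` is a maximal abelian subalgebra of symmetric derivations. -/
def IsMaximalAbelian {n : ℕ} (μ : Bracket n)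
    (𝔞 : Submodule ℝ (Matrix (Fin n) (Fin n) ℝ)) : Prop :=
  Maximal (IsAbelianSub μ) 𝔞

/-- The rank of `μ`: the dimension of a maximal abelian subalgebra of symmetric derivations
(the largest one, should the dimension depend on the choice). -/
noncomputable def rank {n : ℕ} (μ : Bracket n) : ℕ :=
  sSup {d | ∃ 𝔞, IsMaximalAbelian μ 𝔞 ∧ Module.finrank ℝ 𝔞 = d}

/-! ### The lists -/

/-- The 2-form `ij`, with indices counted from 1: it takes the value `1` at `(X_i, X_j)`, `-1` at
`(X_j, X_i)`, and `0` at all other pairs of basis vectors (used for `1 ≤ i, j ≤ n`, `i ≠ j`). -/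
def e {n : ℕ} [NeZero n] (i j : ℕ) : BilForm n :=
  LinearMap.mk₂ ℝ
    (fun x y => x (Fin.ofNat n (i - 1)) * y (Fin.ofNat n (j - 1))
      - x (Fin.ofNat n (j - 1)) * y (Fin.ofNat n (i - 1)))
    (fun x x' y => by simp only [Pi.add_apply]; ring)
    (fun c x y => by simp only [Pi.smul_apply, smul_eq_mul]; ring)
    (fun x y y' => by simp only [Pi.add_apply]; ring)
    (fun c x y => by simp only [Pi.smul_apply, smul_eq_mul]; ring)

/-- The bracket whose `k`-th coordinate is the form `ω k`. -/
def ofForms {n : ℕ} (ω : Fin n → BilForm n) : Bracket n :=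
  LinearMap.mk₂ ℝ (fun x y k => ω k x y)
    (fun x x' y => by ext k; simp)
    (fun c x y => by ext k; simp)
    (fun x y y' => by ext k; simp)
    (fun c x y => by ext k; simp)

/-- Matrices `diag(d)`. -/
abbrev diag {n : ℕ} (d : Fin n → ℝ) : Matrix (Fin n) (Fin n) ℝ := Matrix.diagonal d

/-- A line of the lists: the dimension, the bracket, the value of the rank, and an explicit set
of matrices. -/
structure Row where
  dim : ℕ
  bracket : Bracket dim
  rankValue : ℕ
  torus : Set (Matrix (Fin dim) (Fin dim) ℝ)

/-- The line for the abelian bracket on `ℝⁿ`. -/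
def abelianRow (n : ℕ) : Row := ⟨n, 0, n, {M | ∃ d : Fin n → ℝ, M = diag d}⟩

/-- The names of the nilsolitons of dimension at most 6. Here `R1`, `R2`, `R3`, `eta3`, `lam9`,
`mu34` are the abelian ones and `heis` is the 3-dimensional Heisenberg algebra. -/
inductive Name
  | R1 | R2 | R3 | heis
  | eta1 | eta2 | eta3
  | lam1 | lam2 | lam3 | lam4 | lam5 | lam6 | lam7 | lam8 | lam9
  | mu1 | mu2 | mu3 | mu4 | mu5 | mu6 | mu7 | mu8 | mu9 | mu10 | mu11 | mu12 | mu13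
  | mu14 | mu15 | mu16 | mu17 | mu18 | mu19 | mu20 | mu21 | mu22 | mu23 | mu24 | mu25
  | mu26 | mu27 | mu28 | mu29 | mu30 | mu31 | mu32 | mu33 | mu34

/-- The lists of nilsolitons of dimension at most 6. -/
noncomputable def row : Name → Row
  | .R1 => abelianRow 1
  | .R2 => abelianRow 2
  | .R3 => abelianRow 3
  | .heis => ⟨3, ofForms ![0, 0, e 1 2], 2,
      {M | ∃ a b : ℝ, M = diag ![a, b, a + b]}⟩
  | .eta1 => ⟨4, ofForms ![0, 0, e 1 2, e 1 3], 2,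
      {M | ∃ a b : ℝ, M = diag ![a, b, a + b, 2 * a + b]}⟩
  | .eta2 => ⟨4, ofForms ![0, 0, 0, e 1 2], 3,
      {M | ∃ a b c : ℝ, M = diag ![a, b, c, a + b]}⟩
  | .eta3 => abelianRow 4
  | .lam1 => ⟨5, ofForms ![0, 0, √3 • e 1 2, √4 • e 1 3, √3 • e 1 4], 2,
      {M | ∃ a b : ℝ, M = diag ![a, b, a + b, 2 * a + b, 3 * a + b]}⟩
  | .lam2 => ⟨5, ofForms ![0, 0, √3 • e 1 2, √3 • e 1 3, √2 • e 1 4 + √2 • e 2 3], 1,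
      {M | ∃ a : ℝ, M = a • diag ![1, 2, 3, 4, 5]}⟩
  | .lam3 => ⟨5, ofForms ![0, 0, 0, √2 • e 1 2, e 2 3 + √2 • e 1 4], 2,
      {M | ∃ a b : ℝ, M = diag ![a, b, 2 * a, a + b, 2 * a + b]}⟩
  | .lam4 => ⟨5, ofForms ![0, 0, 0, 0, e 1 2 + e 3 4], 3,
      {M | ∃ a b c : ℝ, M = diag ![a, b, c, a + b - c, a + b]}⟩
  | .lam5 => ⟨5, ofForms ![0, 0, (2 : ℝ) • e 1 2, √3 • e 1 3, √3 • e 2 3], 2,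
      {M | ∃ a b : ℝ, M = diag ![a, b, a + b, 2 * a + b, a + 2 * b]}⟩
  | .lam6 => ⟨5, ofForms ![0, 0, 0, e 1 2, e 1 3], 3,
      {M | ∃ a b c : ℝ, M = diag ![a, b, c, a + b, a + c]}⟩
  | .lam7 => ⟨5, ofForms ![0, 0, 0, 0, e 1 2], 4,
      {M | ∃ a b c d : ℝ, M = diag ![a, b, c, d, a + b]}⟩
  | .lam8 => ⟨5, ofForms ![0, 0, 0, e 1 2, e 1 4], 3,
      {M | ∃ a b c : ℝ, M = diag ![a, b, c, a + b, 2 * a + b]}⟩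
  | .lam9 => abelianRow 5
  | .mu1 => ⟨6, ofForms ![0, 0, √13 • e 1 2, (4 : ℝ) • e 1 3, √12 • e 1 4 + (2 : ℝ) • e 2 3,
        √12 • e 3 4 + √13 • e 5 2], 1,
      {M | ∃ a : ℝ, M = a • diag ![1, 2, 3, 4, 5, 7]}⟩
  | .mu2 => ⟨6, ofForms ![0, 0, e 1 2, √(4 / 3) • e 1 3, e 1 4, e 3 4 + e 5 2], 2,
      {M | ∃ a b : ℝ, M = diag ![a, b, a + b, 2 * a + b, 3 * a + b, 3 * a + 2 * b]}⟩
  | .mu3 => ⟨6, ofForms ![0, 0, (2 : ℝ) • e 1 2, √6 • e 1 3, √6 • e 1 4, (2 : ℝ) • e 1 5], 2,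
      {M | ∃ a b : ℝ, M = diag ![a, b, a + b, 2 * a + b, 3 * a + b, 4 * a + b]}⟩
  | .mu4 => ⟨6, ofForms ![0, 0, √22 • e 1 2, (6 : ℝ) • e 1 3, √22 • e 1 4 + √30 • e 2 3,
        (5 : ℝ) • e 2 4 + √30 • e 1 5], 1,
      {M | ∃ a : ℝ, M = a • diag ![1, 2, 3, 4, 5, 6]}⟩
  | .mu5 => ⟨6, ofForms ![0, 0, √7 • e 1 2, √(15 / 2) • e 1 3, (3 : ℝ) • e 1 4,
        √(15 / 2) • e 2 3 + (2 : ℝ) • e 1 5], 1,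
      {M | ∃ a : ℝ, M = a • diag ![1, 3, 4, 5, 6, 7]}⟩
  | .mu6 => ⟨6, ofForms ![0, 0, e 1 2, e 1 3, e 2 3, e 1 4], 2,
      {M | ∃ a b : ℝ, M = diag ![a, b, a + b, 2 * a + b, a + 2 * b, 3 * a + b]}⟩
  | .mu7 => ⟨6, ofForms ![0, 0, (2 : ℝ) • e 1 2, √5 • e 1 3, √5 • e 2 3,
        (2 : ℝ) • e 1 4 - (2 : ℝ) • e 2 5], 2,
      {M | ∃ a b : ℝ, M =
        !![a, b, 0, 0, 0, 0;
           b, a, 0, 0, 0, 0;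
           0, 0, 2 * a, 0, 0, 0;
           0, 0, 0, 3 * a, b, 0;
           0, 0, 0, b, 3 * a, 0;
           0, 0, 0, 0, 0, 4 * a]}⟩
  | .mu8 => ⟨6, ofForms ![0, 0, (2 : ℝ) • e 1 2, √5 • e 1 3, √5 • e 2 3,
        (2 : ℝ) • e 1 4 + (2 : ℝ) • e 2 5], 1,
      {M | ∃ a : ℝ, M = a • diag ![1, 1, 2, 3, 3, 4]}⟩
  | .mu9 => ⟨6, ofForms ![0, 0, 0, √(5 / 4) • e 1 2, e 1 4 - e 2 3,
        √(5 / 4) • e 1 5 + e 3 4], 2,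
      {M | ∃ a b : ℝ, M = diag ![a, b, 2 * a, a + b, 2 * a + b, 3 * a + b]}⟩
  | .mu10 => ⟨6, ofForms ![0, 0, 0, e 1 2, √(5 / 3) • e 1 4, e 1 5 + e 2 3], 2,
      {M | ∃ a b : ℝ, M = diag ![a, b, 3 * a, a + b, 2 * a + b, 3 * a + b]}⟩
  | .mu11 => ⟨6, ofForms ![0, 0, -√(25 / 56) • e 1 2, √(3 / 7) • e 1 2,
        √(5 / 28) • e 1 4 - √(15 / 14) • e 1 3, √(3 / 4) • e 1 5 + √(7 / 8) • e 2 4], 1,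
      {M | ∃ a : ℝ, M = a • diag ![1, 2, 3, 3, 4, 5]}⟩
  | .mu12 => ⟨6, ofForms ![0, 0, 0, √3 • e 1 2, √3 • e 1 4, √2 • e 1 5 + √2 • e 2 4], 2,
      {M | ∃ a b : ℝ, M = diag ![a, 2 * a, b, 3 * a, 4 * a, 5 * a]}⟩
  | .mu13 => ⟨6, ofForms ![0, 0, 0, √3 • e 1 2, (2 : ℝ) • e 1 4, √3 • e 1 5], 3,
      {M | ∃ a b c : ℝ, M = diag ![a, b, c, a + b, 2 * a + b, 3 * a + b]}⟩
  | .mu14 => ⟨6, ofForms ![0, 0, 0, √3 • e 1 2, √2 • e 1 3, √2 • e 1 4 + √3 • e 3 5], 2,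
      {M | ∃ a b : ℝ, M =
        diag ![a, b, (a + b) / 2, a + b, (3 * a + b) / 2, 2 * a + b]}⟩
  | .mu15 => ⟨6, ofForms ![0, 0, 0, e 1 2, e 2 3, e 1 4 + e 3 5], 3,
      {M | ∃ a b c : ℝ, M =
        !![a, 0, c, 0, 0, 0;
           0, b, 0, 0, 0, 0;
           c, 0, a, 0, 0, 0;
           0, 0, 0, a + b, -c, 0;
           0, 0, 0, -c, a + b, 0;
           0, 0, 0, 0, 0, 2 * a + b]}⟩
  | .mu16 => ⟨6, ofForms ![0, 0, 0, e 1 2, e 2 3, e 1 4 - e 3 5], 2,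
      {M | ∃ a b : ℝ, M = diag ![a, b, a, a + b, a + b, 2 * a + b]}⟩
  | .mu17 => ⟨6, ofForms ![0, 0, 0, (2 : ℝ) • e 1 2, √3 • e 1 4, √3 • e 2 4], 3,
      {M | ∃ a b c : ℝ, M = diag ![a, b, c, a + b, 2 * a + b, a + 2 * b]}⟩
  | .mu18 => ⟨6, ofForms ![0, 0, 0, √2 • e 1 2, (√2)⁻¹ • e 1 3 + √(3 / 2) • e 4 2,
        √(3 / 2) • e 1 4 + (√2)⁻¹ • e 2 3], 1,
      {M | ∃ a : ℝ, M = a • diag ![1, 1, 2, 2, 3, 3]}⟩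
  | .mu19 => ⟨6, ofForms ![0, 0, 0, (2 : ℝ) • e 1 2, √3 • e 1 4, e 1 3 + √3 • e 4 2], 2,
      {M | ∃ a b : ℝ, M = diag ![a, b, 2 * b, a + b, 2 * a + b, a + 2 * b]}⟩
  | .mu20 => ⟨6, ofForms ![0, 0, -e 1 2, √3 • e 1 2, (2 : ℝ) • e 1 4, e 2 4 - √3 • e 2 3], 2,
      {M | ∃ a b : ℝ, M = diag ![a, b, a + b, a + b, 2 * a + b, a + 2 * b]}⟩
  | .mu21 => ⟨6, ofForms ![0, 0, 0, √2 • e 1 2, e 1 3, √2 • e 1 4 + e 2 3], 2,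
      {M | ∃ a b : ℝ, M = diag ![a, b, 2 * a, a + b, 3 * a, 2 * a + b]}⟩
  | .mu22 => ⟨6, ofForms ![0, 0, 0, √(3 / 4) • e 1 2, √(3 / 4) • e 1 3, e 2 4], 3,
      {M | ∃ a b c : ℝ, M = diag ![a, b, c, a + b, a + c, a + 2 * b]}⟩
  | .mu23 => ⟨6, ofForms ![0, 0, 0, √2 • e 1 2, e 1 3, √2 • e 1 4], 3,
      {M | ∃ a b c : ℝ, M = diag ![a, b, c, a + b, a + c, 2 * a + b]}⟩
  | .mu24 => ⟨6, ofForms ![0, 0, 0, e 1 2, e 1 3, e 2 3], 3,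
      {M | ∃ a b c : ℝ, M = diag ![a, b, c, a + b, a + c, b + c]}⟩
  | .mu25 => ⟨6, ofForms ![0, 0, 0, 0, (2 : ℝ) • e 1 2, √3 • e 1 5 + √3 • e 3 4], 3,
      {M | ∃ a b c : ℝ, M = diag ![a, b, c, 2 * a + b - c, a + b, 2 * a + b]}⟩
  | .mu26 => ⟨6, ofForms ![0, 0, 0, 0, e 1 2, e 1 5], 4,
      {M | ∃ a b c d : ℝ, M = diag ![a, b, c, d, a + b, 2 * a + b]}⟩
  | .mu27 => ⟨6, ofForms ![0, 0, 0, 0, √2 • e 1 2, e 1 4 + √2 • e 2 5], 3,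
      {M | ∃ a b c : ℝ, M = diag ![a, b, c, 2 * b, a + b, a + 2 * b]}⟩
  | .mu28 => ⟨6, ofForms ![0, 0, 0, 0, e 1 3 + e 4 2, e 1 4 + e 2 3], 2,
      {M | ∃ a b : ℝ, M = diag ![a, a, b, b, a + b, a + b]}⟩
  | .mu29 => ⟨6, ofForms ![0, 0, 0, 0, e 1 2, e 1 4 + e 2 3], 3,
      {M | ∃ a b c : ℝ, M = diag ![a, b, c, c - a + b, a + b, b + c]}⟩
  | .mu30 => ⟨6, ofForms ![0, 0, 0, 0, e 1 2, e 3 4], 4,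
      {M | ∃ a b c d : ℝ, M = diag ![a, b, c, d, a + b, c + d]}⟩
  | .mu31 => ⟨6, ofForms ![0, 0, 0, 0, e 1 2, e 1 3], 4,
      {M | ∃ a b c d : ℝ, M = diag ![a, b, c, d, a + b, a + c]}⟩
  | .mu32 => ⟨6, ofForms ![0, 0, 0, 0, 0, e 1 2 + e 3 4], 4,
      {M | ∃ a b c d : ℝ, M = diag ![a, b, c, a + b - c, d, a + b]}⟩
  | .mu33 => ⟨6, ofForms ![0, 0, 0, 0, 0, e 1 2], 5,
      {M | ∃ a b c d f : ℝ, M = diag ![a, b, c, d, f, a + b]}⟩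
  | .mu34 => abelianRow 6

end Solsoliton

open Solsoliton

namespace Solsoliton

open Matrix

/-! ### Commuting families of symmetric matrices -/

/-! Two things are needed: for every bracket, all maximal abelian subalgebras of symmetric
derivations have the same dimension; and each line of the list passes a finite verification.

The first is the argument that conjugates maximal abelian subspaces of `𝔭` in a Cartan
decomposition. The orthogonal automorphisms form a compact group that acts on the symmetric
derivations by conjugation. If `A`, `B` are symmetric derivations and `Q` maximises tr(QAQᵀB), then
QAQᵀ commutes with `B`: the derivative along the skew derivation [QAQᵀ, B] is, up to sign, the
squared norm of that commutator (`exists_orthAut_commute`). A commuting family of symmetric matrices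
contains an element with the same centralizer as the family (`exists_mem_forall_commute`). For two
such generic elements, `Q` conjugates one maximal abelian subalgebra into the other
(`finrank_le_of_isMaximalAbelian`).

For the second, every bracket in the list is strictly triangular: [X_i, X_j] involves only X_k with
k > i, j. This gives nilpotency, and it removes the Killing and trace terms from the Ricci operator,
leaving a quadratic expression in the structure constants (`IsAdapted.ricci_apply`). Up to a common
factor κ, the structure constants have the form s√p with integers s, p, so the Jacobi identity and
the Ricci equation become cancellations between integer multiples of square roots, which are decided
by computation.

For maximality it suffices to find one element of the torus whose centralizer among the symmetric
derivations is contained in the torus. The diagonal derivations are the solutions of d_k = d_i + d_j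
over the nonzero structure constants. A matrix that commutes with diag(d) has no entries between
different weights d_i. If all weights differ, it is diagonal. Otherwise the derivation equations at
pairs of equal weights force the entries to vanish, or, for `mu7` and `mu15`, leave exactly one
further parameter. -/

theorem span_jointEigenvectors_eq_top {n : ℕ} (V : Submodule ℝ (Matrix (Fin n) (Fin n) ℝ))
    (hs : ∀ A ∈ V, A.IsSymm) (hc : ∀ A ∈ V, ∀ B ∈ V, Commute A B) :
    ⊤ ≤ Submodule.span ℝ {v : Fin n → ℝ | ∀ A ∈ V, ∃ c : ℝ, A *ᵥ v = c • v} := by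
  have key := LinearMap.IsSymmetric.iSup_iInf_eq_top_of_commute (𝕜 := ℝ)
    (T := fun A : V => toEuclideanLin A.1)
    (fun A => isSymmetric_toEuclideanLin_iff.2 (by
      rw [IsHermitian, conjTranspose_eq_transpose_of_trivial]; exact hs A A.2))
    (fun A B _ => by
      have h := (hc A A.2 B B.2).eq
      ext v i
      have h' := congrArg (fun M => (M *ᵥ v.ofLp) i) h
      simpa [toEuclideanLin, ← mulVec_mulVec] using h')
  intro x _
  have hx : WithLp.toLp 2 x ∈ (⊤ : Submodule ℝ (EuclideanSpace ℝ (Fin n))) := trivial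
  rw [← key] at hx
  suffices H : ∀ y : EuclideanSpace ℝ (Fin n),
      y ∈ (⨆ χ : V → ℝ, ⨅ A : V, Module.End.eigenspace (toEuclideanLin A.1) (χ A)) →
      y.ofLp ∈ Submodule.span ℝ {v : Fin n → ℝ | ∀ A ∈ V, ∃ c : ℝ, A *ᵥ v = c • v} from H _ hx
  intro y hy
  induction hy using Submodule.iSup_induction' with
  | mem χ y hy =>
    refine Submodule.subset_span fun A hA => ⟨χ ⟨A, hA⟩, ?_⟩
    rw [Submodule.mem_iInf] at hy
    have := Module.End.mem_eigenspace_iff.1 (hy ⟨A, hA⟩)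
    simpa [toEuclideanLin] using congrArg WithLp.ofLp this
  | zero => simp
  | add y z _ _ hy hz => simpa using add_mem hy hz

/-- A commuting family of symmetric matrices contains an element whose centralizer is the
centralizer of the family. -/
theorem exists_mem_forall_commute {n : ℕ} (V : Submodule ℝ (Matrix (Fin n) (Fin n) ℝ))
    (hs : ∀ A ∈ V, A.IsSymm) (hc : ∀ A ∈ V, ∀ B ∈ V, Commute A B) :
    ∃ A ∈ V, ∀ M, Commute M A → ∀ B ∈ V, Commute M B := by
  have hspan := span_jointEigenvectors_eq_top V hs hc
  -- The basis need not be orthonormal: the symmetry of the matrices enters only through `hdot`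
  -- below. The eigenvalue of `A` at `b i` is a linear functional `f i` of `A`.
  set b := Module.Basis.ofSpan hspan with hb
  have hbS : ∀ i, ∀ A ∈ V, ∃ c : ℝ, A *ᵥ b i = c • b i := fun i =>
    Module.Basis.ofSpan_subset hspan ⟨i, rfl⟩
  let f : ∀ _ : _, Module.Dual ℝ V := fun i =>
    { toFun := fun A => b.coord i (A.1 *ᵥ b i)
      map_add' := fun A B => by simp [add_mulVec]
      map_smul' := fun c A => by simp [smul_mulVec] }
  have hf : ∀ i (A : V), A.1 *ᵥ b i = f i A • b i := fun i A => by
    obtain ⟨c, hc⟩ := hbS i A A.2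
    have : f i A = c := by
      change b.coord i (A.1 *ᵥ b i) = c
      rw [hc]; simp
    rw [this, hc]
  have hfin := Module.Finite.finite_basis b
  -- A real vector space is not a finite union of hyperplanes, so some `A` separates all the
  -- distinct functionals `f i`. Its eigenspaces are then the joint eigenspaces of the family.
  obtain ⟨A, hA⟩ := Module.Dual.exists_forall_ne_zero_of_forall_exists
    (fun p : {p : _ × _ // f p.1 ≠ f p.2} => f p.1.1 - f p.1.2) (fun p => by
      by_contra h
      push Not at h
      exact p.2 (LinearMap.ext fun x => sub_eq_zero.1 (by simpa using h x)))
  refine ⟨A, A.2, fun M hM B hB => ?_⟩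
  have hdot : ∀ j (C : V) (v : Fin n → ℝ), b j ⬝ᵥ (C.1 *ᵥ v) = f j C * (b j ⬝ᵥ v) :=
    fun j C v => by
      rw [dotProduct_mulVec, ← mulVec_transpose, (hs C C.2).eq, hf, smul_dotProduct, smul_eq_mul]
  have hz : ∀ w : Fin n → ℝ, (∀ j, b j ⬝ᵥ w = 0) → w = 0 := fun w hw => by
    refine dotProduct_self_eq_zero.1 ?_
    have : ∀ x ∈ Submodule.span ℝ (Set.range b), x ⬝ᵥ w = 0 := fun x hx => by
      induction hx using Submodule.span_induction with
      | mem x hx => obtain ⟨j, rfl⟩ := hx; exact hw j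
      | zero => simp
      | add x y _ _ hx hy => rw [add_dotProduct, hx, hy, add_zero]
      | smul c x _ hx => rw [smul_dotProduct, hx, smul_zero]
    exact this w (b.mem_span w)
  have hvec : ∀ i, (M * B) *ᵥ b i = (B * M) *ᵥ b i := fun i => by
    have hv : A.1 *ᵥ (M *ᵥ b i) = f i A • (M *ᵥ b i) := by
      rw [mulVec_mulVec, ← hM.eq, ← mulVec_mulVec, hf, mulVec_smul]
    rw [← mulVec_mulVec, hf i ⟨B, hB⟩, mulVec_smul, ← mulVec_mulVec, eq_comm, ← sub_eq_zero]
    refine hz _ fun j => ?_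
    rw [dotProduct_sub, hdot j ⟨B, hB⟩, dotProduct_smul, smul_eq_mul, ← sub_mul]
    by_cases hij : f j = f i
    · rw [hij, sub_self, zero_mul]
    -- `M *ᵥ b i` stays in the eigenspace of `A` for `f i A`, and is hence orthogonal to every `b j`
    -- with another eigenvalue.
    · have h1 := hdot j A (M *ᵥ b i)
      rw [hv, dotProduct_smul, smul_eq_mul] at h1
      have h2 := hA ⟨(j, i), hij⟩
      rw [LinearMap.sub_apply] at h2
      have h3 : (f j A - f i A) * (b j ⬝ᵥ M *ᵥ b i) = 0 := by linarith
      rw [(mul_eq_zero.1 h3).resolve_left h2, mul_zero]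
  have hlin : (M * B).mulVecLin = (B * M).mulVecLin := b.ext fun i => by
    simpa using hvec i
  exact mulVec_injective (funext fun v => LinearMap.congr_fun hlin v)

/-! ### Orthogonal automorphisms -/

/-- The orthogonal automorphisms of the bracket `μ`. -/
def orthAut {n : ℕ} (μ : Bracket n) : Set (Matrix (Fin n) (Fin n) ℝ) :=
  {Q | Qᵀ * Q = 1 ∧ ∀ x y, Q *ᵥ μ x y = μ (Q *ᵥ x) (Q *ᵥ y)}

theorem one_mem_orthAut {n : ℕ} (μ : Bracket n) : 1 ∈ orthAut μ := by simp [orthAut]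

theorem mul_mem_orthAut {n : ℕ} {μ : Bracket n} {P Q : Matrix (Fin n) (Fin n) ℝ}
    (hP : P ∈ orthAut μ) (hQ : Q ∈ orthAut μ) : P * Q ∈ orthAut μ := by
  refine ⟨?_, fun x y => ?_⟩
  · rw [transpose_mul, Matrix.mul_assoc, ← Matrix.mul_assoc Pᵀ, hP.1, Matrix.one_mul, hQ.1]
  · rw [← mulVec_mulVec, hQ.2, hP.2, mulVec_mulVec, mulVec_mulVec]

theorem transpose_mem_orthAut {n : ℕ} {μ : Bracket n} {Q : Matrix (Fin n) (Fin n) ℝ}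
    (hQ : Q ∈ orthAut μ) : Qᵀ ∈ orthAut μ := by
  have h := mul_eq_one_comm.1 hQ.1
  refine ⟨by rw [transpose_transpose, h], fun x y => ?_⟩
  have := congrArg (Qᵀ *ᵥ ·) (hQ.2 (Qᵀ *ᵥ x) (Qᵀ *ᵥ y))
  simpa [mulVec_mulVec, h, hQ.1] using this.symm

theorem conj_mem_symDer {n : ℕ} {μ : Bracket n} {Q D : Matrix (Fin n) (Fin n) ℝ}
    (hQ : Q ∈ orthAut μ) (hD : D ∈ symDer μ) : Q * D * Qᵀ ∈ symDer μ := by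
  have h := mul_eq_one_comm.1 hQ.1
  refine ⟨?_, fun x y => ?_⟩
  · rw [IsSymm, transpose_mul, transpose_mul, transpose_transpose, hD.1.eq, Matrix.mul_assoc]
  · have h1 := (transpose_mem_orthAut hQ).2 x y
    have h2 := hD.2 (Qᵀ *ᵥ x) (Qᵀ *ᵥ y)
    simp only [← mulVec_mulVec, h1, h2, mulVec_add, hQ.2]
    simp [mulVec_mulVec, h]

theorem isCompact_orthAut {n : ℕ} (μ : Bracket n) : IsCompact (orthAut μ) := by
  have hμ : Continuous fun p : (Fin n → ℝ) × (Fin n → ℝ) => μ p.1 p.2 :=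
    μ.toContinuousBilinearMap.continuous₂
  refine IsCompact.of_isClosed_subset
    (isCompact_univ_pi fun _ : Fin n => isCompact_univ_pi fun _ : Fin n =>
      isCompact_Icc (a := (-1 : ℝ)) (b := 1)) ?_ ?_
  · refine (isClosed_eq (by fun_prop) continuous_const).inter ?_
    have : {Q : Matrix (Fin n) (Fin n) ℝ | ∀ x y, Q *ᵥ μ x y = μ (Q *ᵥ x) (Q *ᵥ y)} =
        ⋂ x, ⋂ y, {Q | Q *ᵥ μ x y = μ (Q *ᵥ x) (Q *ᵥ y)} := by ext Q; simp
    change IsClosed {Q : Matrix (Fin n) (Fin n) ℝ | ∀ x y, Q *ᵥ μ x y = μ (Q *ᵥ x) (Q *ᵥ y)}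
    rw [this]
    refine isClosed_iInter fun x => isClosed_iInter fun y => isClosed_eq (by fun_prop) ?_
    exact hμ.comp ((Continuous.matrix_mulVec continuous_id continuous_const).prodMk
      (Continuous.matrix_mulVec continuous_id continuous_const))
  · intro Q hQ i _ j _
    have : Q ∈ unitaryGroup (Fin n) ℝ := by
      rw [mem_unitaryGroup_iff']
      simpa [star_eq_conjTranspose, conjTranspose_eq_transpose_of_trivial] using hQ.1
    exact abs_le.1 (by simpa using entry_norm_bound_of_unitary this i j)

open scoped Matrix.Norms.Operator in
theorem hasDerivAt_exp_mulVec {n : ℕ} (X : Matrix (Fin n) (Fin n) ℝ) (x : Fin n → ℝ) (t : ℝ) :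
    HasDerivAt (fun s : ℝ => NormedSpace.exp (s • X) *ᵥ x)
      (NormedSpace.exp (t • X) *ᵥ (X *ᵥ x)) t := by
  have h := hasDerivAt_exp_smul_const (𝕂 := ℝ) X t
  have := ((LinearMap.toContinuousLinearMap
    ((mulVecBilin ℝ ℝ).flip x : Matrix (Fin n) (Fin n) ℝ →ₗ[ℝ] Fin n → ℝ)).hasFDerivAt
      (x := NormedSpace.exp (t • X))).comp_hasDerivAt t h
  rw [mulVec_mulVec]
  exact this

-- Skew derivations are tangent to the group of orthogonal automorphisms. These one-parameter groups
-- are the variations used at the maximum in `exists_orthAut_commute`.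
open scoped Matrix.Norms.Operator in
theorem exp_smul_mem_orthAut {n : ℕ} {μ : Bracket n} {X : Matrix (Fin n) (Fin n) ℝ}
    (hX : IsDerivation μ X) (hskew : Xᵀ = -X) (t : ℝ) :
    NormedSpace.exp (t • X) ∈ orthAut μ := by
  have hinv : ∀ s : ℝ, NormedSpace.exp (s • -X) * NormedSpace.exp (s • X) = 1 := fun s => by
    rw [← exp_add_of_commute _ _ (by rw [smul_neg]; exact (Commute.refl _).neg_left)]
    simp
  have hcomm : ∀ s : ℝ, NormedSpace.exp (s • X) * X = X * NormedSpace.exp (s • X) := fun s =>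
    (((Commute.refl X).smul_left s).exp_left).eq
  refine ⟨?_, fun x y => ?_⟩
  · rw [← exp_transpose, transpose_smul, hskew, hinv]
  let E : ℝ → Matrix (Fin n) (Fin n) ℝ := fun s => NormedSpace.exp (s • X)
  have hh : ∀ s, HasDerivAt (fun s => μ (E s *ᵥ x) (E s *ᵥ y))
      (X *ᵥ μ (E s *ᵥ x) (E s *ᵥ y)) s := fun s => by
    have := ContinuousLinearMap.hasDerivAt_of_bilinear (B := μ.toContinuousBilinearMap)
      (fun _ => hasDerivAt_exp_mulVec X x s) (fun _ => hasDerivAt_exp_mulVec X y s)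
    rw [hX]
    simp only [LinearMap.toContinuousBilinearMap_apply, mulVec_mulVec, hcomm] at this
    simp only [mulVec_mulVec, E]
    rw [add_comm]
    exact this
  -- The bracket pulled back by exp(sX) has derivative zero in s, so it equals its value at s = 0.
  have hk : ∀ s, HasDerivAt
      (fun s => NormedSpace.exp (s • -X) *ᵥ μ (E s *ᵥ x) (E s *ᵥ y)) 0 s := fun s => by
    have := ContinuousLinearMap.hasDerivAt_of_bilinear
      (B := (mulVecBilin ℝ ℝ :
        Matrix (Fin n) (Fin n) ℝ →ₗ[ℝ] (Fin n → ℝ) →ₗ[ℝ] Fin n → ℝ).toContinuousBilinearMap)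
      (fun _ => hasDerivAt_exp_smul_const (𝕂 := ℝ) (-X) s) (fun _ => hh s)
    have h0 : NormedSpace.exp (s • -X) *ᵥ (X *ᵥ μ (E s *ᵥ x) (E s *ᵥ y)) +
        (NormedSpace.exp (s • -X) * -X) *ᵥ μ (E s *ᵥ x) (E s *ᵥ y) = 0 := by
      rw [mulVec_mulVec, ← add_mulVec, mul_neg, add_neg_cancel, zero_mulVec]
    rw [← h0]
    exact this
  have hconst := is_const_of_deriv_eq_zero (fun s => (hk s).differentiableAt)
    (fun s => (hk s).deriv) t 0
  simp only [E, zero_smul, NormedSpace.exp_zero, one_mulVec] at hconst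
  rw [← hconst, mulVec_mulVec, mul_eq_one_comm.1 (hinv t), one_mulVec]

/-! ### Conjugacy of maximal abelian subalgebras -/

theorem bracket_isDerivation {n : ℕ} {μ : Bracket n} {A B : Matrix (Fin n) (Fin n) ℝ}
    (hA : IsDerivation μ A) (hB : IsDerivation μ B) : IsDerivation μ (A * B - B * A) :=
  fun x y => by
    simp only [sub_mulVec, ← mulVec_mulVec, hA _ _, hB _ _, mulVec_add, map_sub,
      LinearMap.sub_apply]
    abel

theorem IsAbelianSub.commute {n : ℕ} {μ : Bracket n}
    {𝔞 : Submodule ℝ (Matrix (Fin n) (Fin n) ℝ)} (h : IsAbelianSub μ 𝔞)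
    {A B : Matrix (Fin n) (Fin n) ℝ} (hA : A ∈ 𝔞) (hB : B ∈ 𝔞) : Commute A B :=
  sub_eq_zero.1 (h.2 A hA B hB)

/-- A symmetric derivation that commutes with a maximal abelian subalgebra belongs to it. -/
theorem IsMaximalAbelian.mem_of_commute {n : ℕ} {μ : Bracket n}
    {𝔞 : Submodule ℝ (Matrix (Fin n) (Fin n) ℝ)} (h : IsMaximalAbelian μ 𝔞)
    {M : Matrix (Fin n) (Fin n) ℝ} (hM : M ∈ symDer μ) (hc : ∀ A ∈ 𝔞, Commute M A) : M ∈ 𝔞 := by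
  have hab : IsAbelianSub μ (𝔞 ⊔ Submodule.span ℝ {M}) := by
    refine ⟨sup_le h.1.1 (by simpa using hM), fun A hA B hB => ?_⟩
    obtain ⟨A, hAa, _, hA', rfl⟩ := Submodule.mem_sup.1 hA
    obtain ⟨B, hBa, _, hB', rfl⟩ := Submodule.mem_sup.1 hB
    obtain ⟨a, rfl⟩ := Submodule.mem_span_singleton.1 hA'
    obtain ⟨b, rfl⟩ := Submodule.mem_span_singleton.1 hB'
    have h1 : Commute A (B + b • M) := (h.1.commute hAa hBa).add_right ((hc A
        hAa).symm.smul_right b)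
    have h2 : Commute M (B + b • M) := (hc B hBa).add_right ((Commute.refl M).smul_right b)
    exact sub_eq_zero.2 (h1.add_left (h2.smul_left a)).eq
  exact h.2 hab le_sup_left (Submodule.mem_sup_right (Submodule.mem_span_singleton_self M))

open scoped Matrix.Norms.Operator in
/-- Some conjugate of `A` under the orthogonal automorphisms commutes with `B`. -/
theorem exists_orthAut_commute {n : ℕ} {μ : Bracket n} {A B : Matrix (Fin n) (Fin n) ℝ}
    (hA : A ∈ symDer μ) (hB : B ∈ symDer μ) :
    ∃ Q ∈ orthAut μ, Commute (Q * A * Qᵀ) B := by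
  -- A maximum of this function is a conjugate of `A` as close to `B` as possible, because
  -- conjugation preserves the norm.
  obtain ⟨Q, hQ, hmax⟩ := (isCompact_orthAut μ).exists_isMaxOn ⟨1, one_mem_orthAut μ⟩
    (f := fun Q => trace (Q * A * Qᵀ * B)) (by fun_prop)
  refine ⟨Q, hQ, ?_⟩
  have hA' := conj_mem_symDer hQ hA
  set C := Q * A * Qᵀ with hC
  set X := C * B - B * C with hX
  have hskew : Xᵀ = -X := by
    rw [hX, transpose_sub, transpose_mul C B, transpose_mul B C, hA'.1.eq, hB.1.eq, neg_sub]
  have hder : HasDerivAt (fun s : ℝ => trace (NormedSpace.exp (s • X) * C *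
      NormedSpace.exp (s • -X) * B)) (trace ((X * C - C * X) * B)) 0 := by
    have h := (((hasDerivAt_exp_smul_const (𝕂 := ℝ) X 0).mul_const C).mul
      (hasDerivAt_exp_smul_const (𝕂 := ℝ) (-X) 0)).mul_const B
    have := ((LinearMap.toContinuousLinearMap (traceLinearMap (Fin n) ℝ ℝ)).hasFDerivAt
      (x := (NormedSpace.exp ((0 : ℝ) • X) * C * NormedSpace.exp ((0 : ℝ) • -X) * B))
      ).comp_hasDerivAt (0 : ℝ) h
    simp only [zero_smul, NormedSpace.exp_zero, Matrix.one_mul, Matrix.mul_one, mul_neg,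
      ← sub_eq_add_neg] at this
    exact this
  have hloc : IsLocalMax (fun s : ℝ => trace (NormedSpace.exp (s • X) * C *
      NormedSpace.exp (s • -X) * B)) 0 := by
    refine Filter.Eventually.of_forall fun s => ?_
    have hs := hmax (mul_mem_orthAut
      (exp_smul_mem_orthAut (bracket_isDerivation hA'.2 hB.2) hskew s) hQ)
    simp only [Set.mem_ofPred_eq, transpose_mul, ← exp_transpose, transpose_smul] at hs
    rw [← hX, hskew] at hs
    simpa [hC, Matrix.mul_assoc] using hs
  have h0 := hloc.hasDerivAt_eq_zero hder
  -- The derivative at the maximum is tr([X, C]B) = tr(X[C, B]) = tr(X²), which is −tr(XXᵀ) since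
  -- `X` is skew.
  have h1 : trace (X * Xᵀ) = 0 := by
    have : ∀ Y, trace (Y * (C * B - B * C)) = trace ((Y * C - C * Y) * B) := fun Y => by
      rw [mul_sub, sub_mul, trace_sub, trace_sub, ← Matrix.mul_assoc Y B C,
        ← Matrix.mul_assoc Y C B, trace_mul_cycle Y B C]
    rw [hskew, Matrix.mul_neg, trace_neg, neg_eq_zero, ← h0, ← this X]
  have h2 := trace_mul_conjTranspose_self_eq_zero_iff.1
    (show trace (X * Xᴴ) = 0 by rwa [conjTranspose_eq_transpose_of_trivial])
  exact sub_eq_zero.1 h2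

/-- Take generic `A` in `𝔞` and `B` in `𝔟`, and `Q` such that QAQᵀ commutes with `B`. As `B` is
generic, QAQᵀ commutes with `𝔟`, so it lies in `𝔟` by maximality. Hence QᵀMQ commutes with `A` for
each `M` in `𝔟`. As `A` is generic and `𝔞` maximal, QᵀMQ lies in `𝔞`, and conjugation embeds `𝔟` in
`𝔞`. -/
theorem finrank_le_of_isMaximalAbelian {n : ℕ} {μ : Bracket n}
    {𝔞 𝔟 : Submodule ℝ (Matrix (Fin n) (Fin n) ℝ)} (ha : IsMaximalAbelian μ 𝔞)
    (hb : IsMaximalAbelian μ 𝔟) : Module.finrank ℝ 𝔟 ≤ Module.finrank ℝ 𝔞 := by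
  obtain ⟨A, hA, hA'⟩ := exists_mem_forall_commute 𝔞 (fun A hA => (ha.1.1 hA).1)
    fun A hA B hB => ha.1.commute hA hB
  obtain ⟨B, hB, hB'⟩ := exists_mem_forall_commute 𝔟 (fun A hA => (hb.1.1 hA).1)
    fun A hA B hB => hb.1.commute hA hB
  obtain ⟨Q, hQ, hQc⟩ := exists_orthAut_commute (ha.1.1 hA) (hb.1.1 hB)
  have hQ' := mul_eq_one_comm.1 hQ.1
  have hconj : ∀ M : Matrix (Fin n) (Fin n) ℝ, Qᵀ * (Q * M * Qᵀ) * Q = M := fun M => by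
    rw [Matrix.mul_assoc Q, ← Matrix.mul_assoc Qᵀ, hQ.1, Matrix.one_mul, Matrix.mul_assoc, hQ.1,
      Matrix.mul_one]
  have hmul : ∀ M N : Matrix (Fin n) (Fin n) ℝ,
      Qᵀ * M * Q * (Qᵀ * N * Q) = Qᵀ * (M * N) * Q := fun M N => by
    simp only [Matrix.mul_assoc]
    rw [← Matrix.mul_assoc Q Qᵀ, hQ', Matrix.one_mul]
  have hmem : ∀ M ∈ 𝔟, Qᵀ * M * Q ∈ 𝔞 := fun M hM => by
    have hM' : Qᵀ * M * Q ∈ symDer μ := by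
      simpa using conj_mem_symDer (transpose_mem_orthAut hQ) (hb.1.1 hM)
    refine ha.mem_of_commute hM' (hA' _ ?_)
    have := hb.1.commute hM (hb.mem_of_commute (conj_mem_symDer hQ (ha.1.1 hA)) (hB' _ hQc))
    have h2 := congrArg (fun N => Qᵀ * N * Q) this.eq
    rw [← hmul M, ← hmul (Q * A * Qᵀ) M, hconj] at h2
    exact h2
  let φ : 𝔟 →ₗ[ℝ] 𝔞 :=
    { toFun := fun M => ⟨Qᵀ * M.1 * Q, hmem M M.2⟩
      map_add' := fun M N => Subtype.ext (by simp [Matrix.mul_add, Matrix.add_mul])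
      map_smul' := fun c M => Subtype.ext (by simp) }
  refine LinearMap.finrank_le_finrank_of_injective (f := φ) fun M N h => Subtype.ext ?_
  have := congrArg (fun P => Q * P.1 * Qᵀ) h
  have hback : ∀ M : Matrix (Fin n) (Fin n) ℝ, Q * (Qᵀ * M * Q) * Qᵀ = M := fun M => by
    rw [Matrix.mul_assoc Qᵀ, ← Matrix.mul_assoc Q, hQ', Matrix.one_mul, Matrix.mul_assoc, hQ',
      Matrix.mul_one]
  simpa only [φ, LinearMap.coe_mk, AddHom.coe_mk, hback] using this

/-- All maximal abelian subalgebras of symmetric derivations have dimension `rank μ`. -/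
theorem IsMaximalAbelian.finrank_eq_rank {n : ℕ} {μ : Bracket n}
    {𝔞 : Submodule ℝ (Matrix (Fin n) (Fin n) ℝ)} (ha : IsMaximalAbelian μ 𝔞) :
    Module.finrank ℝ 𝔞 = rank μ := by
  have : {d | ∃ 𝔟, IsMaximalAbelian μ 𝔟 ∧ Module.finrank ℝ 𝔟 = d} = {Module.finrank ℝ 𝔞} := by
    ext d
    refine ⟨fun ⟨𝔟, hb, hd⟩ => ?_, fun hd => ⟨𝔞, ha, hd.symm⟩⟩
    rw [Set.mem_singleton_iff, ← hd]
    exact le_antisymm (finrank_le_of_isMaximalAbelian ha hb) (finrank_le_of_isMaximalAbelian hb ha)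
  rw [rank, this, csSup_singleton]

/-! ### Structure constants -/

/-- The structure constants of `μ` in the canonical basis. -/
def structConst {n : ℕ} (μ : Bracket n) (i j k : Fin n) : ℝ := μ (basisVec i) (basisVec j) k

theorem basisVec_induction {n : ℕ} {P : (Fin n → ℝ) → Prop} (hb : ∀ i, P (basisVec i))
    (h0 : P 0) (hadd : ∀ x y, P x → P y → P (x + y)) (hsmul : ∀ (c : ℝ) x, P x → P (c • x))
    (x : Fin n → ℝ) : P x := by
  have : x ∈ Submodule.span ℝ (Set.range (Pi.basisFun ℝ (Fin n))) := (Pi.basisFun ℝ _).mem_span x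
  induction this using Submodule.span_induction with
  | mem x hx => obtain ⟨i, rfl⟩ := hx; simpa [basisVec] using hb i
  | zero => exact h0
  | add x y _ _ hx hy => exact hadd x y hx hy
  | smul c x _ hx => exact hsmul c x hx

theorem eq_sum_basisVec {n : ℕ} (x : Fin n → ℝ) : x = ∑ i, x i • basisVec i := by
  simpa [basisVec] using ((Pi.basisFun ℝ (Fin n)).sum_repr x).symm

@[simp]
theorem dotProduct_basisVec {n : ℕ} (x : Fin n → ℝ) (k : Fin n) : x ⬝ᵥ basisVec k = x k := by
  simp [basisVec]

theorem bracket_apply_eq_sum {n : ℕ} (μ : Bracket n) (x y : Fin n → ℝ) (k : Fin n) :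
    μ x y k = ∑ i, ∑ j, x i * y j * structConst μ i j k := by
  conv_lhs => rw [eq_sum_basisVec x, eq_sum_basisVec y]
  simp only [map_sum, map_smul, LinearMap.sum_apply, LinearMap.smul_apply, Finset.sum_apply,
    Pi.smul_apply, smul_eq_mul, structConst, Finset.mul_sum]
  rw [Finset.sum_comm]
  exact Finset.sum_congr rfl fun i _ => Finset.sum_congr rfl fun j _ => by ring

theorem bracket_swap {n : ℕ} {μ : Bracket n}
    (h : ∀ i j k, structConst μ j i k = -structConst μ i j k) (x y : Fin n → ℝ) :
    μ y x = -μ x y := by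
  induction x using basisVec_induction with
  | hb i =>
    induction y using basisVec_induction with
    | hb j => exact funext fun k => h i j k
    | h0 => simp
    | hadd x y hx hy => simp [hx, hy, add_comm]
    | hsmul c x hx => simp [hx]
  | h0 => simp
  | hadd x y hx hy => simp [hx, hy, add_comm]
  | hsmul c x hx => simp [hx]

theorem jacobi_of_basisVec {n : ℕ} {μ : Bracket n}
    (h : ∀ i j k, μ (basisVec i) (μ (basisVec j) (basisVec k)) +
      μ (basisVec j) (μ (basisVec k) (basisVec i)) +
      μ (basisVec k) (μ (basisVec i) (basisVec j)) = 0) (x y z : Fin n → ℝ) :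
    μ x (μ y z) + μ y (μ z x) + μ z (μ x y) = 0 := by
  have add3 : ∀ {a b c a' b' c' : Fin n → ℝ}, a + b + c = 0 → a' + b' + c' = 0 →
      (a + a') + (b + b') + (c + c') = 0 := fun {a b c a' b' c'} h h' => by
    rw [show (a + a') + (b + b') + (c + c') = (a + b + c) + (a' + b' + c') by abel, h, h', add_zero]
  have smul3 : ∀ (r : ℝ) {a b c : Fin n → ℝ}, a + b + c = 0 → r • a + r • b + r • c = 0 :=
    fun r {a b c} h => by rw [← smul_add, ← smul_add, h, smul_zero]
  induction x using basisVec_induction with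
  | hb i =>
    induction y using basisVec_induction with
    | hb j =>
      induction z using basisVec_induction with
      | hb k => exact h i j k
      | h0 => simp
      | hadd x y hx hy => simpa using add3 hx hy
      | hsmul c x hx => simpa using smul3 c hx
    | h0 => simp
    | hadd x y hx hy => simpa using add3 hx hy
    | hsmul c x hx => simpa using smul3 c hx
  | h0 => simp
  | hadd x y hx hy => simpa using add3 hx hy
  | hsmul c x hx => simpa using smul3 c hx

theorem isDerivation_diag {n : ℕ} {μ : Bracket n} {d : Fin n → ℝ}
    (h : ∀ i j k, structConst μ i j k ≠ 0 → d k = d i + d j) : IsDerivation μ (diag d) := by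
  have hd : ∀ i : Fin n, diag d *ᵥ basisVec i = d i • basisVec i := fun i => by
    simp [basisVec, ← Pi.single_smul]
  intro x y
  induction x using basisVec_induction with
  | hb i =>
    induction y using basisVec_induction with
    | hb j =>
      funext k
      rw [hd, hd, mulVec_diagonal]
      simp only [map_smul, LinearMap.smul_apply, Pi.add_apply, Pi.smul_apply, smul_eq_mul]
      change d k * structConst μ i j k = d i * structConst μ i j k + d j * structConst μ i j k
      by_cases hc : structConst μ i j k = 0
      · simp [hc]
      · rw [h i j k hc, add_mul]
    | h0 => simp
    | hadd x y hx hy => simp only [map_add, mulVec_add, hx, hy]; abel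
    | hsmul c x hx => simp only [map_smul, mulVec_smul, hx, smul_add]
  | h0 => simp
  | hadd x y hx hy => simp only [map_add, mulVec_add, LinearMap.add_apply, hx, hy]; abel
  | hsmul c x hx => simp only [map_smul, mulVec_smul, LinearMap.smul_apply, hx, smul_add]

/-- The derivation identity in terms of structure constants. -/
theorem IsDerivation.structConst_eq {n : ℕ} {μ : Bracket n} {D : Matrix (Fin n) (Fin n) ℝ}
    (h : IsDerivation μ D) (i j k : Fin n) :
    ∑ l, D k l * structConst μ i j l =
      ∑ l, (D l i * structConst μ l j k + D l j * structConst μ i l k) := by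
  have hcol : ∀ i : Fin n, D *ᵥ basisVec i = ∑ l, D l i • basisVec l := fun i => by
    conv_lhs => rw [eq_sum_basisVec (D *ᵥ basisVec i)]
    simp [basisVec, Matrix.col]
  have := congrFun (h (basisVec i) (basisVec j)) k
  rw [hcol i, hcol j] at this
  simpa [mulVec, dotProduct, structConst, Finset.sum_add_distrib] using this

theorem eq_add_of_isDerivation_diag {n : ℕ} {μ : Bracket n} {d : Fin n → ℝ}
    (h : IsDerivation μ (diag d)) {i j k : Fin n} (hc : structConst μ i j k ≠ 0) :
    d k = d i + d j := by
  have := h.structConst_eq i j k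
  simp only [diagonal_apply, ite_mul, zero_mul, Finset.sum_add_distrib, Finset.sum_ite_eq,
    Finset.sum_ite_eq', Finset.mem_univ, if_true, ← add_mul] at this
  exact mul_right_cancel₀ hc this

/-! ### Nilpotent brackets adapted to the canonical basis -/

/-- The bracket `μ` is skew-symmetric, and `[X_i, X_j]` lies in the span of the `X_k` with
`i, j < k`. -/
structure IsAdapted {n : ℕ} (μ : Bracket n) : Prop where
  swap : ∀ i j k, structConst μ j i k = -structConst μ i j k
  lt : ∀ i j k, structConst μ i j k ≠ 0 → i < k ∧ j < k

theorem IsAdapted.isNilpotentLie {n : ℕ} {μ : Bracket n} (h : IsAdapted μ)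
    (hJ : ∀ i j k, μ (basisVec i) (μ (basisVec j) (basisVec k)) +
      μ (basisVec j) (μ (basisVec k) (basisVec i)) +
      μ (basisVec k) (μ (basisVec i) (basisVec j)) = 0) : IsNilpotentLie μ where
  alternating x := self_eq_neg.1 (bracket_swap h.swap x x)
  jacobi := jacobi_of_basisVec hJ
  nilpotent := by
    -- Each step of the lower central series kills one more of the leading coordinates.
    have key : ∀ m, ∀ z ∈ lowerCentral μ m, ∀ k : Fin n, k.val < m → z k = 0 := by
      intro m
      induction m with
      | zero => intro z _ k hk; exact absurd hk (Nat.not_lt_zero _)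
      | succ m ih =>
        intro z hz k hk
        induction hz using Submodule.span_induction with
        | mem z hz =>
          obtain ⟨x, y, hy, rfl⟩ := hz
          rw [bracket_apply_eq_sum]
          refine Finset.sum_eq_zero fun i _ => Finset.sum_eq_zero fun j _ => ?_
          by_cases hc : structConst μ i j k = 0
          · rw [hc, mul_zero]
          · have hj : j.val < m := lt_of_lt_of_le (h.lt i j k hc).2 (Nat.lt_succ_iff.1 hk)
            rw [ih y hy j hj, mul_zero, zero_mul]
        | zero => rfl
        | add x y _ _ hx hy => rw [Pi.add_apply, hx, hy, add_zero]
        | smul c x _ hx => rw [Pi.smul_apply, hx, smul_zero]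
    exact ⟨n, (Submodule.eq_bot_iff _).2 fun z hz => funext fun k => key n z hz k k.2⟩

theorem leviCivita_apply_eq_sum {n : ℕ} (μ : Bracket n) (x y : Fin n → ℝ) (k : Fin n) :
    leviCivita μ x y k = ∑ i, ∑ j, x i * y j * ((1 / 2) * (structConst μ i j k -
      structConst μ j k i + structConst μ k i j)) := by
  have h1 : μ y (basisVec k) ⬝ᵥ x = ∑ i, ∑ j, x i * y j * structConst μ j k i := by
    simp only [dotProduct, bracket_apply_eq_sum μ y]
    refine Finset.sum_congr rfl fun i _ => ?_
    simp [basisVec, Pi.single_apply, Finset.sum_mul]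
    exact Finset.sum_congr rfl fun j _ => by ring
  have h2 : μ (basisVec k) x ⬝ᵥ y = ∑ i, ∑ j, x i * y j * structConst μ k i j := by
    simp only [dotProduct, bracket_apply_eq_sum μ _ x]
    rw [Finset.sum_comm' (t' := Finset.univ) (s' := fun _ => Finset.univ) (by simp)]
    simp [basisVec, Pi.single_apply, Finset.sum_mul]
    exact Finset.sum_congr rfl fun j _ => Finset.sum_congr rfl fun j _ => by ring
  rw [leviCivita, dotProduct_basisVec, h1, h2, bracket_apply_eq_sum]
  simp only [← Finset.sum_sub_distrib, ← Finset.sum_add_distrib, Finset.mul_sum]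
  exact Finset.sum_congr rfl fun j _ => Finset.sum_congr rfl fun j _ => by ring

/-- In the Ricci formula the summands agree only after symmetrisation in the two summation indices.
-/
theorem sum_sum_eq_of_add_swap {n : ℕ} {f g : Fin n → Fin n → ℝ}
    (h : ∀ k m, f k m + f m k = g k m + g m k) : ∑ k, ∑ m, f k m = ∑ k, ∑ m, g k m := by
  have h1 : ∀ f : Fin n → Fin n → ℝ, ∑ k, ∑ m, (f k m + f m k) = 2 * ∑ k, ∑ m, f k m :=
    fun f => by
      simp only [Finset.sum_add_distrib]
      rw [Finset.sum_comm (f := fun k m => f m k), two_mul]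
  have h2 := h1 f
  simp only [h] at h2
  rw [h1 g] at h2
  linarith

/-- The Ricci operator of a nilpotent bracket. -/
theorem IsAdapted.ricci_apply {n : ℕ} {μ : Bracket n} (h : IsAdapted μ) (i j : Fin n) :
    ricci μ i j = (1 / 4) * ∑ k, ∑ m, (-2 * (structConst μ i k m * structConst μ j k m) +
      structConst μ k m i * structConst μ k m j) := by
  have hΓ : ∀ (i : Fin n) (y : Fin n → ℝ) (k : Fin n), leviCivita μ (basisVec i) y k =
      ∑ m, y m * ((1 / 2) * (structConst μ i m k - structConst μ m k i + structConst μ k i m)) :=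
    fun i y k => by
      rw [leviCivita_apply_eq_sum]
      simp [basisVec, Pi.single_apply]
  have hΓ' : ∀ (x : Fin n → ℝ) (j k : Fin n), leviCivita μ x (basisVec j) k =
      ∑ m, x m * ((1 / 2) * (structConst μ m j k - structConst μ j k m + structConst μ k m j)) :=
    fun x j k => by
      rw [leviCivita_apply_eq_sum]
      simp [basisVec, Pi.single_apply]
  have hΓb : ∀ i j k : Fin n, leviCivita μ (basisVec i) (basisVec j) k =
      (1 / 2) * (structConst μ i j k - structConst μ j k i + structConst μ k i j) :=
    fun i j k => by rw [hΓ]; simp [basisVec, Pi.single_apply]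
  have hself : ∀ i k, structConst μ i i k = 0 := fun i k => self_eq_neg.1 (h.swap i i k)
  have hlt : ∀ {i j k}, ¬ (i < k ∧ j < k) → structConst μ i j k = 0 := fun {i j k} hn => by
    by_contra hc
    exact hn (h.lt i j k hc)
  -- These are the terms of the Killing form. Triangularity would require both k < m and m < k.
  have hK : ∀ i j k m, structConst μ i k m * structConst μ j m k = 0 := fun i j k m => by
    rcases lt_or_ge k m with hkm | hkm
    · rw [hlt (i := j) (fun h => lt_asymm hkm h.2), mul_zero]
    · rw [hlt (i := i) (fun h => absurd h.2 (not_lt.2 hkm)), zero_mul]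
  have hR : ∀ k, curvature μ (basisVec k) (basisVec i) (basisVec j) k = ∑ m,
      ((1 / 2) * (structConst μ i j m - structConst μ j m i + structConst μ m i j) *
        ((1 / 2) * (structConst μ k m k - structConst μ m k k + structConst μ k k m)) -
      (1 / 2) * (structConst μ k j m - structConst μ j m k + structConst μ m k j) *
        ((1 / 2) * (structConst μ i m k - structConst μ m k i + structConst μ k i m)) -
      structConst μ k i m *
        ((1 / 2) * (structConst μ m j k - structConst μ j k m + structConst μ k m j))) :=
    fun k => by
      rw [curvature, Pi.sub_apply, Pi.sub_apply, hΓ k, hΓ i, hΓ' (μ _ _)]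
      simp only [hΓb, ← Finset.sum_sub_distrib]
      rfl
  simp only [ricci, of_apply, dotProduct_basisVec, hR, Finset.mul_sum]
  refine sum_sum_eq_of_add_swap fun k m => ?_
  -- No bracket has a component along either of its arguments, so the first product of connection
  -- coefficients vanishes.
  have e1 : ∀ a b : Fin n, structConst μ a b a = 0 := fun a b => hlt fun h => lt_irrefl _ h.1
  have e2 : ∀ a b : Fin n, structConst μ b a a = 0 := fun a b => hlt fun h => lt_irrefl _ h.2
  simp only [e1, e2, hself, sub_zero, add_zero, mul_zero, zero_sub]
  rw [h.swap j k m, h.swap j m k, h.swap i k m, h.swap i m k, h.swap m k i, h.swap m k j]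
  have k1 := hK i j k m
  have k2 := hK i j m k
  rw [h.swap k m i, h.swap k m j]
  linear_combination (-1 / 2 : ℝ) * k1 + (-1 / 2 : ℝ) * k2

/-! ### Formal linear combinations of square roots -/

/-- The pair `(s, p)` stands for the real number `s √p`. -/
noncomputable def rad (a : ℤ × ℕ) : ℝ := a.1 * √(a.2 : ℝ)

/-- The product of `s √p` and `s' √p'`, with the common factor of `p` and `p'` taken out of the
root. -/
def mulRad (a b : ℤ × ℕ) : ℤ × ℕ :=
  (a.1 * b.1 * (Nat.gcd a.2 b.2 : ℤ), a.2 / Nat.gcd a.2 b.2 * (b.2 / Nat.gcd a.2 b.2))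

/-- √(gp')·√(gq') = g√(p'q'). In particular the square of a root becomes an integer multiple of √1,
and can cancel against integers. -/
theorem rad_mulRad (a b : ℤ × ℕ) : rad (mulRad a b) = rad a * rad b := by
  obtain ⟨s, p⟩ := a
  obtain ⟨t, q⟩ := b
  simp only [rad, mulRad]
  obtain ⟨p', hp⟩ := Nat.gcd_dvd_left p q
  obtain ⟨q', hq⟩ := Nat.gcd_dvd_right p q
  generalize Nat.gcd p q = g at hp hq ⊢
  subst hp hq
  rcases Nat.eq_zero_or_pos g with rfl | hg
  · simp
  rw [Nat.mul_div_cancel_left _ hg, Nat.mul_div_cancel_left _ hg]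
  have hs := Real.mul_self_sqrt (Nat.cast_nonneg (α := ℝ) g)
  push_cast
  rw [Real.sqrt_mul (Nat.cast_nonneg p'), Real.sqrt_mul (Nat.cast_nonneg g),
    Real.sqrt_mul (Nat.cast_nonneg g)]
  linear_combination (-(s : ℝ) * t * √(p' : ℝ) * √(q' : ℝ)) * hs

/-- Formal vectors: a list of triples `(l, s, p)`, standing for the sum of the `s √p X_l`. -/
abbrev FormalVec : Type := List (ℕ × ℤ × ℕ)

/-- The `l`-th coordinate of a formal vector. -/
noncomputable def formalCoord (v : FormalVec) (l : ℕ) : ℝ :=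
  (v.map fun a => if a.1 = l then rad a.2 else 0).sum

@[simp]
theorem formalCoord_nil (l : ℕ) : formalCoord [] l = 0 := rfl

@[simp]
theorem formalCoord_cons (a : ℕ × ℤ × ℕ) (v : FormalVec) (l : ℕ) :
    formalCoord (a :: v) l = (if a.1 = l then rad a.2 else 0) + formalCoord v l := by
  simp [formalCoord]

@[simp]
theorem formalCoord_append (v w : FormalVec) (l : ℕ) :
    formalCoord (v ++ w) l = formalCoord v l + formalCoord w l := by
  simp [formalCoord]

theorem formalCoord_flatMap {α : Type} (s : List α) (f : α → FormalVec) (l : ℕ) :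
    formalCoord (s.flatMap f) l = (s.map fun a => formalCoord (f a) l).sum := by
  induction s with
  | nil => rfl
  | cons a s ih => rw [List.flatMap_cons, formalCoord_append, ih, List.map_cons, List.sum_cons]

theorem formalCoord_flatMap_finRange {n : ℕ} (f : Fin n → FormalVec) (l : ℕ) :
    formalCoord ((List.finRange n).flatMap f) l = ∑ i, formalCoord (f i) l := by
  rw [formalCoord_flatMap, Fin.sum_univ_def]

theorem exists_mem_of_formalCoord_ne_zero {v : FormalVec} {l : ℕ} (h : formalCoord v l ≠ 0) :
    ∃ a ∈ v, a.1 = l := by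
  by_contra hn
  push Not at hn
  refine h (List.sum_eq_zero fun x hx => ?_)
  obtain ⟨a, ha, rfl⟩ := List.mem_map.1 hx
  exact if_neg (hn a ha)

/-- Passes from sums over the list of terms to sums over coordinates. The bounds ensure that no term
falls outside the range 1, …, n. -/
theorem sum_map_rad_mul {n : ℕ} {v : FormalVec} (hv : ∀ a ∈ v, 1 ≤ a.1 ∧ a.1 ≤ n) (g : ℕ → ℝ) :
    (v.map fun a => rad a.2 * g a.1).sum = ∑ m : Fin n, formalCoord v (m + 1) * g (m + 1) := by
  induction v with
  | nil => simp
  | cons a v ih =>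
    rw [List.map_cons, List.sum_cons, ih fun b hb => hv b (List.mem_cons_of_mem _ hb)]
    simp only [formalCoord_cons, add_mul, Finset.sum_add_distrib, ite_mul, zero_mul]
    obtain ⟨h1, h2⟩ := hv a List.mem_cons_self
    congr 1
    rw [Finset.sum_eq_single (⟨a.1 - 1, by omega⟩ : Fin n)]
    · simp [Nat.sub_add_cancel h1]
    · intro b _ hb
      refine if_neg fun h => hb (Fin.ext ?_)
      simp [h]
    · simp

/-- Multiplication of all the coefficients of the formal vector `w` by `a`, where only the terms at
`l` are kept, and are put at `m`. -/
def mulCoord (a : ℤ × ℕ) (w : FormalVec) (l m : ℕ) : FormalVec :=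
  (w.filter fun b => b.1 = l).map fun b => (m, mulRad a b.2)

theorem formalCoord_mulCoord (a : ℤ × ℕ) (w : FormalVec) (l m : ℕ) :
    formalCoord (mulCoord a w l m) m = rad a * formalCoord w l := by
  induction w with
  | nil => simp [mulCoord]
  | cons b w ih =>
    rw [mulCoord] at ih ⊢
    rw [List.filter_cons]
    by_cases h : b.1 = l
    · simp [h, ih, rad_mulRad, mul_add]
    · simp [h, ih]

/-- The inner product of formal vectors. -/
def innerFormal (u w : FormalVec) : FormalVec := u.flatMap fun a => mulCoord a.2 w a.1 0

theorem formalCoord_innerFormal {n : ℕ} {u : FormalVec} (hu : ∀ a ∈ u, 1 ≤ a.1 ∧ a.1 ≤ n)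
    (w : FormalVec) :
    formalCoord (innerFormal u w) 0 = ∑ m : Fin n, formalCoord u (m + 1) * formalCoord w (m +
        1) := by
  rw [innerFormal, formalCoord_flatMap, ← sum_map_rad_mul hu (formalCoord w)]
  simp only [formalCoord_mulCoord]

/-- The product of the `i`-th and the `j`-th coordinate of a formal vector. -/
def coordMul (u : FormalVec) (i j : ℕ) : FormalVec :=
  u.flatMap fun a => if a.1 = i then mulCoord a.2 u j 0 else []

theorem formalCoord_coordMul (u : FormalVec) (i j : ℕ) :
    formalCoord (coordMul u i j) 0 = formalCoord u i * formalCoord u j := by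
  rw [coordMul, formalCoord_flatMap]
  conv_rhs => rw [formalCoord, ← List.sum_map_mul_right]
  congr 1
  refine List.map_congr_left fun a _ => ?_
  split_ifs
  · rw [formalCoord_mulCoord]
  · simp

/-- All coefficients of a formal vector vanish after terms with the same root are collected. -/
def IsFormalZero (v : FormalVec) : Prop :=
  ∀ a ∈ v, (v.map fun b => if b.1 = a.1 ∧ b.2.2 = a.2.2 then b.2.1 else 0).sum = 0

instance (v : FormalVec) : Decidable (IsFormalZero v) :=
  inferInstanceAs (Decidable (∀ a ∈ v, _))

/-- Grouped by radicand, a coordinate is a sum of integers times √q, and all these integers are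
zero. Only this direction is used, so linear independence of square roots plays no role. -/
theorem IsFormalZero.formalCoord_eq_zero {v : FormalVec} (h : IsFormalZero v) (l : ℕ) :
    formalCoord v l = 0 := by
  have key : ∀ (v : FormalVec) (S : Finset ℕ), (∀ a ∈ v, a.2.2 ∈ S) → formalCoord v l =
      ∑ q ∈ S, (((v.map fun b => if b.1 = l ∧ b.2.2 = q then b.2.1 else 0).sum : ℤ) : ℝ) *
        √(q : ℝ) := by
    intro v S hS
    induction v with
    | nil => simp
    | cons b v ih =>
      rw [formalCoord_cons, ih fun a ha => hS a (List.mem_cons_of_mem _ ha)]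
      simp only [List.map_cons, List.sum_cons, Int.cast_add, add_mul, Finset.sum_add_distrib]
      congr 1
      by_cases hb : b.1 = l
      · simp [hb, rad, hS b List.mem_cons_self]
      · simp [hb]
  rw [key v (v.map fun a => a.2.2).toFinset fun a ha => by
    simpa using ⟨_, _, ha⟩]
  refine Finset.sum_eq_zero fun q _ => ?_
  by_cases hq : ∃ a ∈ v, a.1 = l ∧ a.2.2 = q
  · obtain ⟨a, ha, rfl, rfl⟩ := hq
    rw [h a ha, Int.cast_zero, zero_mul]
  · rw [List.sum_eq_zero, Int.cast_zero, zero_mul]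
    intro x hx
    obtain ⟨b, hb, rfl⟩ := List.mem_map.1 hx
    exact if_neg fun h' => hq ⟨b, hb, h'⟩

/-! ### Brackets given by tables of structure constants -/

/-- The entry `⟨i, j, k, s, p⟩` of a table stands for `[X_i, X_j] = s √p X_k + ⋯`, with indices
counted from 1. -/
structure Entry where
  i : ℕ
  j : ℕ
  k : ℕ
  s : ℤ
  p : ℕ

/-- The 2-form in the `k`-th coordinate of the bracket with a given table. -/
noncomputable def tableForm {n : ℕ} [NeZero n] (L : List Entry) (k : ℕ) : BilForm n :=
  (L.map fun t => if t.k = k then rad (t.s, t.p) • e t.i t.j else 0).sum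

/-- The formal vector `[X_i, X_j]`. -/
def tableBracket (L : List Entry) (i j : ℕ) : FormalVec :=
  L.flatMap fun t => if t.i = i ∧ t.j = j then [(t.k, t.s, t.p)]
    else if t.i = j ∧ t.j = i then [(t.k, -t.s, t.p)] else []

/-- The formal vector `[X_i, v]`. -/
def tableAd (L : List Entry) (i : ℕ) (v : FormalVec) : FormalVec :=
  v.flatMap fun a => (tableBracket L i a.1).map fun b => (b.1, mulRad a.2 b.2)

/-- The Jacobi sum of `X_i, X_j, X_k`. -/
def tableJacobi (L : List Entry) (i j k : ℕ) : FormalVec :=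
  tableAd L i (tableBracket L j k) ++ tableAd L j (tableBracket L k i) ++
    tableAd L k (tableBracket L i j)

/-- Four times the Ricci form at `X_i, X_j`. -/
def tableRicci (n : ℕ) (L : List Entry) (i j : ℕ) : FormalVec :=
  (List.finRange n).flatMap fun k : Fin n =>
    innerFormal ((tableBracket L i (k + 1)).map fun a => (a.1, -2 * a.2.1, a.2.2))
      (tableBracket L j (k + 1)) ++
    (List.finRange n).flatMap fun m : Fin n => coordMul (tableBracket L (k + 1) (m + 1)) i j

/-- The entries of a table are strictly triangular. -/
def IsTriangular (n : ℕ) (L : List Entry) : Prop :=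
  ∀ t ∈ L, 1 ≤ t.i ∧ 1 ≤ t.j ∧ t.i ≠ t.j ∧ t.i < t.k ∧ t.j < t.k ∧ t.k ≤ n

instance (n : ℕ) (L : List Entry) : Decidable (IsTriangular n L) :=
  inferInstanceAs (Decidable (∀ t ∈ L, _))

/-- The bracket with table `L` is a nilsoliton with Ricci operator `diag R / 4 = c / 4 I + D`, and
no two entries of `L` are at the same place. -/
def IsSolitonTable (n : ℕ) (L : List Entry) (R : List ℤ) (c : ℤ) : Prop :=
  IsTriangular n L ∧
  (∀ i j k : Fin n, IsFormalZero (tableJacobi L (i + 1) (j + 1) (k + 1))) ∧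
  (∀ i j : Fin n, IsFormalZero (tableRicci n L (i + 1) (j + 1) ++
    if i = j then [(0, -R.getD i 0, 1)] else [])) ∧
  (∀ t ∈ L, R.getD (t.k - 1) 0 + c = R.getD (t.i - 1) 0 + R.getD (t.j - 1) 0) ∧
  ∀ t ∈ L, t.s ≠ 0 ∧ t.p ≠ 0 ∧
    (tableBracket L t.i t.j).filter (fun a => a.1 = t.k) = [(t.k, t.s, t.p)]

instance (n : ℕ) (L : List Entry) (R : List ℤ) (c : ℤ) :
    Decidable (IsSolitonTable n L R c) := by
  unfold IsSolitonTable
  infer_instance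

theorem e_swap {n : ℕ} [NeZero n] (i j : ℕ) (x y : Fin n → ℝ) : e i j y x = -e i j x y := by
  simp only [e, LinearMap.mk₂_apply]
  ring

theorem tableForm_cons {n : ℕ} [NeZero n] (t : Entry) (L : List Entry) (k : ℕ) (x y : Fin n → ℝ) :
    tableForm (t :: L) k x y =
      (if t.k = k then rad (t.s, t.p) * e t.i t.j x y else 0) + tableForm L k x y := by
  rw [tableForm, List.map_cons, List.sum_cons, LinearMap.add_apply, LinearMap.add_apply]
  congr 1
  split_ifs <;> simp

theorem tableForm_swap {n : ℕ} [NeZero n] (L : List Entry) (k : ℕ) (x y : Fin n → ℝ) :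
    tableForm L k y x = -tableForm L k x y := by
  induction L with
  | nil => simp [tableForm]
  | cons t L ih =>
    rw [tableForm_cons, tableForm_cons, ih, e_swap]
    split_ifs <;> ring

theorem basisVec_ofNat {n : ℕ} [NeZero n] (a : Fin n) {i : ℕ} (h1 : 1 ≤ i) (h2 : i ≤ n) :
    basisVec a (Fin.ofNat n (i - 1)) = if i = a + 1 then 1 else 0 := by
  have : Fin.ofNat n (i - 1) = a ↔ i = a + 1 := by
    rw [Fin.ext_iff, Fin.val_ofNat, Nat.mod_eq_of_lt (by omega)]
    omega
  rw [basisVec, Pi.single_apply]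
  simp only [this]

theorem tableBracket_cons (t : Entry) (L : List Entry) (i j : ℕ) :
    tableBracket (t :: L) i j = (if t.i = i ∧ t.j = j then [(t.k, t.s, t.p)]
      else if t.i = j ∧ t.j = i then [(t.k, -t.s, t.p)] else []) ++ tableBracket L i j :=
  List.flatMap_cons

theorem tableForm_basisVec {n : ℕ} [NeZero n] {L : List Entry} (hL : IsTriangular n L)
    (k : ℕ) (a b : Fin n) :
    tableForm L k (basisVec a) (basisVec b) = formalCoord (tableBracket L (a + 1) (b + 1)) k := by
  induction L with
  | nil => simp [tableForm, tableBracket]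
  | cons t L ih =>
    have ht := hL t List.mem_cons_self
    rw [tableForm_cons, ih fun t ht => hL t (List.mem_cons_of_mem _ ht), tableBracket_cons,
      formalCoord_append]
    congr 1
    simp only [e, LinearMap.mk₂_apply]
    rw [basisVec_ofNat a ht.1 (by omega), basisVec_ofNat b ht.1 (by omega),
      basisVec_ofNat a ht.2.1 (by omega), basisVec_ofNat b ht.2.1 (by omega)]
    -- Since `t.i ≠ t.j`, at most one of the two products in the 2-form is nonzero, matching the
    -- exclusive branches of `tableBracket`.
    by_cases h1 : t.i = a + 1 <;> by_cases h2 : t.j = b + 1 <;>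
      by_cases h3 : t.i = b + 1 <;> by_cases h4 : t.j = a + 1 <;>
      first
      | (exfalso; omega)
      | (have hab : (a : ℕ) ≠ b := by omega
         simp [h1, h2, h3, h4, rad, hab, hab.symm])
      | simp [h1, h2, h3, h4, rad]

theorem exists_entry_of_mem_tableBracket {L : List Entry} {i j : ℕ} {a : ℕ × ℤ × ℕ}
    (h : a ∈ tableBracket L i j) :
    ∃ t ∈ L, t.k = a.1 ∧ (t.i = i ∧ t.j = j ∨ t.i = j ∧ t.j = i) := by
  obtain ⟨t, ht, ha⟩ := List.mem_flatMap.1 h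
  refine ⟨t, ht, ?_⟩
  split_ifs at ha with h1 h2
  · rw [List.mem_singleton.1 ha]; exact ⟨rfl, Or.inl h1⟩
  · rw [List.mem_singleton.1 ha]; exact ⟨rfl, Or.inr h2⟩
  · simp at ha

theorem IsTriangular.mem_range {n : ℕ} {L : List Entry} (hL : IsTriangular n L) {i j : ℕ}
    (a : ℕ × ℤ × ℕ) (h : a ∈ tableBracket L i j) : 1 ≤ a.1 ∧ a.1 ≤ n := by
  obtain ⟨t, ht, hk, _⟩ := exists_entry_of_mem_tableBracket h
  have := hL t ht
  omega

/-- The bracket `μ` is `κ` times the bracket with table `L`. -/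
def HasTable {n : ℕ} (μ : Bracket n) (κ : ℝ) (L : List Entry) : Prop :=
  IsTriangular n L ∧
  ∀ i j k, structConst μ i j k = κ * formalCoord (tableBracket L (i + 1) (j + 1)) (k + 1)

theorem HasTable.exists_entry {n : ℕ} {μ : Bracket n} {κ : ℝ} {L : List Entry}
    (h : HasTable μ κ L) {i j k : Fin n} (hc : structConst μ i j k ≠ 0) :
    ∃ t ∈ L, t.k = k + 1 ∧ (t.i = i + 1 ∧ t.j = j + 1 ∨ t.i = j + 1 ∧ t.j = i + 1) := by
  rw [h.2] at hc
  obtain ⟨a, ha, hk⟩ := exists_mem_of_formalCoord_ne_zero (right_ne_zero_of_mul hc)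
  rw [← hk]
  exact exists_entry_of_mem_tableBracket ha

theorem hasTable_ofForms {n : ℕ} [NeZero n] {ω : Fin n → BilForm n} {κ : ℝ} {L : List Entry}
    (hL : IsTriangular n L) (hω : ∀ k : Fin n, ω k = κ • tableForm L (k + 1)) :
    HasTable (ofForms ω) κ L :=
  ⟨hL, fun i j k => by
    simp [structConst, ofForms, hω, tableForm_basisVec hL]⟩

theorem HasTable.isAdapted {n : ℕ} [NeZero n] {μ : Bracket n} {κ : ℝ} {L : List Entry}
    (h : HasTable μ κ L) : IsAdapted μ where
  swap i j k := by
    rw [h.2, h.2, ← tableForm_basisVec h.1, tableForm_swap, tableForm_basisVec h.1, mul_neg]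
  lt i j k hc := by
    obtain ⟨t, ht, hk, hij⟩ := h.exists_entry hc
    have := h.1 t ht
    rw [Fin.lt_def, Fin.lt_def]
    omega

/-- The Jacobi sum is homogeneous of degree two in the bracket, so the factor κ plays no role in the
check on the table. -/
theorem HasTable.isNilpotentLie {n : ℕ} [NeZero n] {μ : Bracket n} {κ : ℝ} {L : List Entry}
    (h : HasTable μ κ L)
    (hJ : ∀ i j k : Fin n, IsFormalZero (tableJacobi L (i + 1) (j + 1) (k + 1))) :
    IsNilpotentLie μ := by
  refine h.isAdapted.isNilpotentLie fun i j k => funext fun l => ?_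
  have key : ∀ i j k : Fin n, μ (basisVec i) (μ (basisVec j) (basisVec k)) l =
      κ * κ * formalCoord (tableAd L (i + 1) (tableBracket L (j + 1) (k + 1))) (l + 1) := fun
          i j k => by
    have hmap : ∀ (c : ℤ × ℕ) (w : FormalVec) (l : ℕ),
        formalCoord (w.map fun b => (b.1, mulRad c b.2)) l = rad c * formalCoord w l := fun c
            w l => by
      induction w with
      | nil => simp
      | cons b w ih =>
        rw [List.map_cons, formalCoord_cons, formalCoord_cons, ih, rad_mulRad, mul_add,
            mul_ite, mul_zero]
    rw [tableAd, formalCoord_flatMap]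
    simp only [hmap]
    rw [sum_map_rad_mul h.1.mem_range fun m => formalCoord (tableBracket L (i + 1) m) (l + 1)]
    rw [bracket_apply_eq_sum]
    simp only [basisVec, Pi.single_apply, ite_mul, one_mul, zero_mul, Finset.sum_ite_irrel,
      Finset.sum_const_zero, Finset.sum_ite_eq', Finset.mem_univ, if_true, Finset.mul_sum]
    refine Finset.sum_congr rfl fun m _ => ?_
    change structConst μ j k m * structConst μ i m l = _
    rw [h.2, h.2]
    ring
  have := (hJ i j k).formalCoord_eq_zero (l + 1)
  rw [tableJacobi, formalCoord_append, formalCoord_append] at this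
  rw [Pi.add_apply, Pi.add_apply, key, key, key, ← mul_add, ← mul_add, this, mul_zero,
      Pi.zero_apply]

theorem HasTable.ricci_apply {n : ℕ} [NeZero n] {μ : Bracket n} {κ : ℝ} {L : List Entry}
    (h : HasTable μ κ L) (i j : Fin n) :
    ricci μ i j = κ ^ 2 / 4 * formalCoord (tableRicci n L (i + 1) (j + 1)) 0 := by
  have hneg : ∀ (w : FormalVec) (l : ℕ),
      formalCoord (w.map fun a => (a.1, -2 * a.2.1, a.2.2)) l = -2 * formalCoord w l := fun w
          l => by
    induction w with
    | nil => simp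
    | cons b w ih =>
      rw [List.map_cons, formalCoord_cons, formalCoord_cons, ih, mul_add]
      simp [rad, mul_assoc]
  rw [h.isAdapted.ricci_apply, tableRicci, formalCoord_flatMap_finRange, Finset.mul_sum,
      Finset.mul_sum]
  refine Finset.sum_congr rfl fun k _ => ?_
  rw [formalCoord_append, formalCoord_innerFormal (n := n) (by
    intro a ha
    obtain ⟨b, hb, rfl⟩ := List.mem_map.1 ha
    exact h.1.mem_range b hb), formalCoord_flatMap_finRange, ← Finset.sum_add_distrib,
        Finset.mul_sum,
    Finset.mul_sum]
  refine Finset.sum_congr rfl fun m _ => ?_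
  rw [formalCoord_coordMul, hneg, h.2, h.2, h.2, h.2]
  ring

theorem HasTable.isDerivation_diag {n : ℕ} {μ : Bracket n} {κ : ℝ} {L : List Entry}
    (h : HasTable μ κ L) {d : ℕ → ℝ} (hd : ∀ t ∈ L, d t.k = d t.i + d t.j) :
    IsDerivation μ (diag fun i : Fin n => d (i + 1)) := by
  refine Solsoliton.isDerivation_diag fun i j k hc => ?_
  obtain ⟨t, ht, hk, ⟨hi, hj⟩ | ⟨hi, hj⟩⟩ := h.exists_entry hc
  · rw [← hk, ← hi, ← hj, hd t ht]
  · rw [← hk, ← hi, ← hj, hd t ht, add_comm]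

theorem HasTable.isNilsoliton {n : ℕ} [NeZero n] {μ : Bracket n} {κ : ℝ} {L : List Entry}
    {R : List ℤ} {c : ℤ} (h : HasTable μ κ L) (hL : IsSolitonTable n L R c) : IsNilsoliton μ := by
  obtain ⟨-, hJ, hR, hc, -⟩ := hL
  -- The derivation is Ric − cI. With D = (R − c)/4 the equation D_k = D_i + D_j reads R_k + c = R_i
  -- + R_j, and passing from the table to μ multiplies everything by κ². Tables count indices from 1
  -- and `R` counts from 0, hence the shift.
  refine ⟨h.isNilpotentLie hJ, κ ^ 2 / 4 * c,
    diag fun i : Fin n => κ ^ 2 / 4 * ((R.getD i 0 : ℤ) - c),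
    h.isDerivation_diag (d := fun i => κ ^ 2 / 4 * ((R.getD (i - 1) 0 : ℤ) - c))
      fun t ht => ?_, ?_⟩
  · have : ((R.getD (t.k - 1) 0 : ℤ) : ℝ) + c =
      (R.getD (t.i - 1) 0 : ℤ) + (R.getD (t.j - 1) 0 : ℤ) := mod_cast hc t ht
    linear_combination κ ^ 2 / 4 * this
  · ext i j
    have := (hR i j).formalCoord_eq_zero 0
    simp only [h.ricci_apply, Matrix.add_apply, Matrix.smul_apply, Matrix.one_apply,
      diagonal_apply]
    by_cases hij : i = j
    · subst hij
      simp only [formalCoord_append, if_true, formalCoord_cons, rad, formalCoord_nil,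
          Int.cast_neg, Nat.cast_one,
        Real.sqrt_one, smul_eq_mul] at this ⊢
      linear_combination κ ^ 2 / 4 * this
    · simp only [if_neg hij, List.append_nil, smul_zero, add_zero] at this ⊢
      rw [this, mul_zero]

/-- The diagonal vector `m` satisfies the equations of a derivation of the bracket with table
`L`. -/
def IsWeight {n : ℕ} [NeZero n] (L : List Entry) (m : Fin n → ℝ) : Prop :=
  ∀ t ∈ L, m (Fin.ofNat n (t.k - 1)) = m (Fin.ofNat n (t.i - 1)) + m (Fin.ofNat n (t.j - 1))

/-- The last clause of `IsSolitonTable` excludes zero entries and cancellation between entries. Each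
entry is thus a nonzero structure constant and imposes its own equation on the weights. -/
theorem HasTable.isDerivation_diag_iff {n : ℕ} [NeZero n] {μ : Bracket n} {κ : ℝ}
    {L : List Entry} {R : List ℤ} {c : ℤ} (h : HasTable μ κ L) (hκ : κ ≠ 0)
    (hL : IsSolitonTable n L R c)
    (m : Fin n → ℝ) : IsDerivation μ (diag m) ↔ IsWeight L m := by
  constructor
  · intro hm t ht
    obtain ⟨h1, h2, -, h3, h4, h5⟩ := h.1 t ht
    obtain ⟨hs, hp, hf⟩ := hL.2.2.2.2 t ht
    have hv : ∀ (v : FormalVec) (l : ℕ), formalCoord (v.filter fun a => a.1 = l) l =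
        formalCoord v l := by
      intro v l
      induction v with
      | nil => rfl
      | cons a v ih =>
        rw [List.filter_cons]
        by_cases ha : a.1 = l <;> simp [ha, ih]
    have hof : ∀ i, 1 ≤ i → i ≤ n → (Fin.ofNat n (i - 1)).val + 1 = i := fun i h1 h2 => by
      rw [Fin.val_ofNat, Nat.mod_eq_of_lt (by omega), Nat.sub_add_cancel h1]
    refine eq_add_of_isDerivation_diag hm ?_
    rw [h.2, hof _ h1 (by omega), hof _ h2 (by omega), hof _ (by omega) h5, ← hv, hf]
    simpa [rad] using ⟨hκ, hs, hp⟩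
  · intro hm
    have := h.isDerivation_diag (d := fun i => m (Fin.ofNat n (i - 1))) hm
    simpa [Fin.ofNat_val_eq_self] using this

/-! ### Rows of the lists -/

/-- What is claimed about a line of the lists. -/
def IsCorrect (R : Row) : Prop :=
  IsNilsoliton R.bracket ∧
  (∃ 𝔞 : Submodule ℝ (Matrix (Fin R.dim) (Fin R.dim) ℝ),
    (𝔞 : Set (Matrix (Fin R.dim) (Fin R.dim) ℝ)) = R.torus ∧ IsMaximalAbelian R.bracket 𝔞) ∧
  (∀ 𝔞 : Submodule ℝ (Matrix (Fin R.dim) (Fin R.dim) ℝ),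
    IsMaximalAbelian R.bracket 𝔞 → Module.finrank ℝ 𝔞 = Solsoliton.rank R.bracket) ∧
  Solsoliton.rank R.bracket = R.rankValue

/-- Any abelian subalgebra containing `𝔞` commutes with `A`, so it lies in the centralizer and hence
in `𝔞`. The dimension of this one maximal subalgebra is the rank, by
`IsMaximalAbelian.finrank_eq_rank`. -/
theorem isCorrect_of_centralizer {n r : ℕ} {μ : Bracket n} {T : Set (Matrix (Fin n) (Fin n) ℝ)}
    (hμ : IsNilsoliton μ) (𝔞 : Submodule ℝ (Matrix (Fin n) (Fin n) ℝ)) (hT : (𝔞 : Set _) = T)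
    (hab : IsAbelianSub μ 𝔞) (hr : Module.finrank ℝ 𝔞 = r) {A : Matrix (Fin n) (Fin n) ℝ}
    (hA : A ∈ 𝔞) (hcent : ∀ M ∈ symDer μ, Commute M A → M ∈ 𝔞) : IsCorrect ⟨n, μ, r, T⟩ := by
  have hmax : IsMaximalAbelian μ 𝔞 :=
    ⟨hab, fun 𝔟 hb hle M hM => hcent M (hb.1 hM) (hb.commute hM (hle hA))⟩
  exact ⟨hμ, ⟨𝔞, hT, hmax⟩, fun _ h => h.finrank_eq_rank, hmax.finrank_eq_rank.symm.trans hr⟩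

/-- The space of the vectors `m` such that `diag m` is a derivation of the bracket with
table `L`. -/
def weightSpace (n : ℕ) [NeZero n] (L : List Entry) : Submodule ℝ (Fin n → ℝ) where
  carrier := {m | IsWeight L m}
  zero_mem' := fun t _ => by simp
  add_mem' := fun {a b} ha hb t ht => by
    simp only [Pi.add_apply, ha t ht, hb t ht]; ring
  smul_mem' := fun c a ha t ht => by
    simp only [Pi.smul_apply, ha t ht, smul_add]

/-- `F` parametrises the solutions of the weight equations, and `g` names the coordinates at which
the `r` free parameters can be read off. -/
theorem finrank_map_weightSpace {n r : ℕ} [NeZero n] {L : List Entry}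
    {F : (Fin r → ℝ) → Fin n → ℝ} {g : Fin r → Fin n} (hg : ∀ a i, F a (g i) = a i)
    (hF : ∀ m, IsWeight L m ↔ m = F fun i => m (g i)) :
    Module.finrank ℝ ((weightSpace n L).map (diagonalLinearMap (Fin n) ℝ ℝ)) = r := by
  have hinj : Function.Injective (diagonalLinearMap (Fin n) ℝ ℝ) := diagonal_injective
  rw [(Submodule.equivMapOfInjective _ hinj (weightSpace n L)).symm.finrank_eq]
  let φ : weightSpace n L →ₗ[ℝ] Fin r → ℝ := LinearMap.funLeft ℝ ℝ g ∘ₗ (weightSpace n L).subtype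
  have hφ : Function.Bijective φ := by
    constructor
    · intro x y h
      have : (fun i => x.1 (g i)) = fun i => y.1 (g i) := h
      exact Subtype.ext (by rw [(hF x.1).1 x.2, (hF y.1).1 y.2, this])
    · intro a
      have ha : (fun i => F a (g i)) = a := funext (hg a)
      exact ⟨⟨F a, (hF (F a)).2 (by rw [ha])⟩, ha⟩
  rw [(LinearEquiv.ofBijective φ hφ).finrank_eq, Module.finrank_fin_fun]

/-- A bracket given by a table, such that the derivations commuting with some diagonal derivation
are diagonal. -/
theorem isCorrect_of_offDiag_eq_zero {n r : ℕ} [NeZero n] {ω : Fin n → BilForm n}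
    {T : Set (Matrix (Fin n) (Fin n) ℝ)} (κ : ℝ) (L : List Entry)
    (R : List ℤ) (c : ℤ)
    (F : (Fin r → ℝ) → Fin n → ℝ) (g : Fin r → Fin n) (w : Fin r → ℝ)
    (hT : T = {M | ∃ a, M = diag (F a)})
    (hκ : κ ≠ 0)
    (hL : IsSolitonTable n L R c)
    (hω : ∀ k : Fin n, ω k = κ • tableForm L (k + 1))
    (hg : ∀ a i, F a (g i) = a i)
    (hF : ∀ m, IsWeight L m ↔ m = F fun i => m (g i))
    (hoff : ∀ M ∈ symDer (ofForms ω), (∀ i j, M i j * F w j = F w i * M i j) →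
      ∀ i j, i ≠ j → M i j = 0) :
    IsCorrect ⟨n, ofForms ω, r, T⟩ := by
  have htab := hasTable_ofForms hL.1 hω
  have hFw : ∀ a, IsWeight L (F a) := fun a => (hF _).2 (by rw [funext (hg a)])
  refine isCorrect_of_centralizer (htab.isNilsoliton hL)
    ((weightSpace n L).map (diagonalLinearMap (Fin n) ℝ ℝ)) ?_ ⟨?_, ?_⟩
    (finrank_map_weightSpace hg hF) ⟨F w, hFw w, rfl⟩ ?_
  · ext M
    rw [hT]
    exact ⟨fun ⟨m, hm, h⟩ => ⟨_, by rw [← (hF m).1 hm]; exact h.symm⟩,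
      fun ⟨a, h⟩ => ⟨F a, hFw a, h.symm⟩⟩
  · rintro _ ⟨m, hm, rfl⟩
    exact ⟨isSymm_diagonal m, (htab.isDerivation_diag_iff hκ hL m).2 hm⟩
  · rintro _ ⟨m, hm, rfl⟩ _ ⟨m', hm', rfl⟩
    exact sub_eq_zero.2 (commute_diagonal m m').eq
  · intro M hM hc
    have hMd : M = diag fun i => M i i := by
      refine (isDiag_iff_diagonal_diag M).1 (fun i j hij => hoff M hM (fun i j => ?_) i j
          hij)|>.symm
      simpa using congrFun (congrFun hc.eq i) j
    rw [hMd]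
    refine ⟨_, ?_, rfl⟩
    exact (htab.isDerivation_diag_iff hκ hL _).1 (hMd ▸ hM.2)

/-- The test element has parameters 1, 10, 100, …. When the weights take pairwise different values
there, every matrix commuting with it is diagonal. -/
theorem isCorrect_of_table {n r : ℕ} [NeZero n] {ω : Fin n → BilForm n}
    {T : Set (Matrix (Fin n) (Fin n) ℝ)} (κ : ℝ) (L : List Entry)
    (R : List ℤ) (c : ℤ)
    (F : (Fin r → ℝ) → Fin n → ℝ) (g : Fin r → Fin n)
    (hT : T = {M | ∃ a, M = diag (F a)})
    (hκ : κ ≠ 0 := by positivity)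
    (hL : IsSolitonTable n L R c := by decide +kernel)
    (hω : ∀ k : Fin n, ω k = κ • tableForm L (k + 1) := by
      intro k; fin_cases k <;> simp [tableForm, rad])
    (hg : ∀ a i, F a (g i) = a i := by
      intro a i; fin_cases i <;> simp)
    (hF : ∀ m, IsWeight L m ↔ m = F fun i => m (g i) := by
      intro m
      simp [IsWeight, funext_iff, Fin.forall_fin_succ]
      try grind)
    (hinj : Function.Injective (F fun i => 10 ^ (i : ℕ)) := by
      intro i j
      fin_cases i <;> fin_cases j <;> norm_num) :
    IsCorrect ⟨n, ofForms ω, r, T⟩ := by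
  refine isCorrect_of_offDiag_eq_zero κ L R c F g (fun i => 10 ^ (i : ℕ)) hT hκ hL hω hg hF
    fun M _ hc i j hij => ?_
  by_contra h0
  exact hij (hinj (mul_left_cancel₀ h0 ((hc i j).trans (mul_comm _ _)))).symm

/-- This and the next four statements gather the parameters of a line into a single vector, as the
criteria above require. -/
theorem torus_fin_one {n : ℕ} (v : Fin n → ℝ) :
    {M | ∃ a : ℝ, M = a • diag v} = {M | ∃ x : Fin 1 → ℝ, M = diag (x 0 • v)} := by
  ext M
  simp only [Set.mem_ofPred_eq, ← diagonal_smul]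
  exact ⟨fun ⟨a, h⟩ => ⟨![a], h⟩, fun ⟨x, h⟩ => ⟨x 0, h⟩⟩

theorem torus_fin_two {α : Type} (f : ℝ → ℝ → α) :
    {M | ∃ a b, M = f a b} = {M | ∃ x : Fin 2 → ℝ, M = f (x 0) (x 1)} :=
  Set.ext fun _ => ⟨fun ⟨a, b, h⟩ => ⟨![a, b], h⟩, fun ⟨x, h⟩ => ⟨x 0, x 1, h⟩⟩

theorem torus_fin_three {α : Type} (f : ℝ → ℝ → ℝ → α) :
    {M | ∃ a b c, M = f a b c} = {M | ∃ x : Fin 3 → ℝ, M = f (x 0) (x 1) (x 2)} :=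
  Set.ext fun _ => ⟨fun ⟨a, b, c, h⟩ => ⟨![a, b, c], h⟩, fun ⟨x, h⟩ => ⟨x 0, x 1, x 2, h⟩⟩

theorem torus_fin_four {α : Type} (f : ℝ → ℝ → ℝ → ℝ → α) :
    {M | ∃ a b c d, M = f a b c d} = {M | ∃ x : Fin 4 → ℝ, M = f (x 0) (x 1) (x 2) (x 3)} :=
  Set.ext fun _ => ⟨fun ⟨a, b, c, d, h⟩ => ⟨![a, b, c, d], h⟩,
    fun ⟨x, h⟩ => ⟨x 0, x 1, x 2, x 3, h⟩⟩

theorem torus_fin_five {α : Type} (f : ℝ → ℝ → ℝ → ℝ → ℝ → α) :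
    {M | ∃ a b c d e, M = f a b c d e} =
      {M | ∃ x : Fin 5 → ℝ, M = f (x 0) (x 1) (x 2) (x 3) (x 4)} :=
  Set.ext fun _ => ⟨fun ⟨a, b, c, d, e, h⟩ => ⟨![a, b, c, d, e], h⟩,
    fun ⟨x, h⟩ => ⟨x 0, x 1, x 2, x 3, x 4, h⟩⟩

/-! ### Lines with pairwise different weights and integral radicands -/

theorem isCorrect_heis : IsCorrect (row .heis) :=
  isCorrect_of_table 1 [⟨1, 2, 3, 1, 1⟩]
    -- Four times the Ricci eigenvalues and four times the constant c: here Ric = diag(−1/2, −1/2,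
    -- 1/2) = −3/2 I + diag(1, 1, 2). The other lines follow the same pattern, up to the factor κ².
    [-2, -2, 2] (-6)
    (fun x => ![x 0, x 1, x 0 + x 1]) ![0, 1]
    (torus_fin_two _)

theorem isCorrect_eta1 : IsCorrect (row .eta1) :=
  isCorrect_of_table 1 [⟨1, 2, 3, 1, 1⟩, ⟨1, 3, 4, 1, 1⟩]
    [-4, -2, 0, 2] (-6)
    (fun x => ![x 0, x 1, x 0 + x 1, 2 * x 0 + x 1]) ![0, 1]
    (torus_fin_two _)

theorem isCorrect_eta2 : IsCorrect (row .eta2) :=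
  isCorrect_of_table 1 [⟨1, 2, 4, 1, 1⟩]
    [-2, -2, 0, 2] (-6)
    (fun x => ![x 0, x 1, x 2, x 0 + x 1]) ![0, 1, 2]
    (torus_fin_three _)

theorem isCorrect_lam1 : IsCorrect (row .lam1) :=
  isCorrect_of_table 1 [⟨1, 2, 3, 1, 3⟩, ⟨1, 3, 4, 1, 4⟩, ⟨1, 4, 5, 1, 3⟩]
    [-20, -6, -2, 2, 6] (-24)
    (fun x => ![x 0, x 1, x 0 + x 1, 2 * x 0 + x 1, 3 * x 0 + x 1]) ![0, 1]
    (torus_fin_two _)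

theorem isCorrect_lam2 : IsCorrect (row .lam2) :=
  isCorrect_of_table 1 [⟨1, 2, 3, 1, 3⟩, ⟨1, 3, 4, 1, 3⟩, ⟨1, 4, 5, 1, 2⟩, ⟨2, 3, 5, 1, 2⟩]
    [-16, -10, -4, 2, 8] (-22)
    (fun x => x 0 • ![1, 2, 3, 4, 5]) ![0]
    (torus_fin_one _)

theorem isCorrect_lam3 : IsCorrect (row .lam3) :=
  isCorrect_of_table 1 [⟨1, 2, 4, 1, 2⟩, ⟨2, 3, 5, 1, 1⟩, ⟨1, 4, 5, 1, 2⟩]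
    [-8, -6, -2, 0, 6] (-14)
    (fun x => ![x 0, x 1, 2 * x 0, x 0 + x 1, 2 * x 0 + x 1]) ![0, 1]
    (torus_fin_two _)

theorem isCorrect_lam4 : IsCorrect (row .lam4) :=
  isCorrect_of_table 1 [⟨1, 2, 5, 1, 1⟩, ⟨3, 4, 5, 1, 1⟩]
    [-2, -2, -2, -2, 4] (-8)
    (fun x => ![x 0, x 1, x 2, x 0 + x 1 - x 2, x 0 + x 1]) ![0, 1, 2]
    (torus_fin_three _)

theorem isCorrect_lam5 : IsCorrect (row .lam5) :=
  isCorrect_of_table 1 [⟨1, 2, 3, 2, 1⟩, ⟨1, 3, 4, 1, 3⟩, ⟨2, 3, 5, 1, 3⟩]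
    [-14, -14, -4, 6, 6] (-24)
    (fun x => ![x 0, x 1, x 0 + x 1, 2 * x 0 + x 1, x 0 + 2 * x 1]) ![0, 1]
    (torus_fin_two _)

theorem isCorrect_lam6 : IsCorrect (row .lam6) :=
  isCorrect_of_table 1 [⟨1, 2, 4, 1, 1⟩, ⟨1, 3, 5, 1, 1⟩]
    [-4, -2, -2, 2, 2] (-8)
    (fun x => ![x 0, x 1, x 2, x 0 + x 1, x 0 + x 2]) ![0, 1, 2]
    (torus_fin_three _)

theorem isCorrect_lam7 : IsCorrect (row .lam7) :=
  isCorrect_of_table 1 [⟨1, 2, 5, 1, 1⟩]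
    [-2, -2, 0, 0, 2] (-6)
    (fun x => ![x 0, x 1, x 2, x 3, x 0 + x 1]) ![0, 1, 2, 3]
    (torus_fin_four _)

theorem isCorrect_lam8 : IsCorrect (row .lam8) :=
  isCorrect_of_table 1 [⟨1, 2, 4, 1, 1⟩, ⟨1, 4, 5, 1, 1⟩]
    [-4, -2, 0, 0, 2] (-6)
    (fun x => ![x 0, x 1, x 2, x 0 + x 1, 2 * x 0 + x 1]) ![0, 1, 2]
    (torus_fin_three _)

theorem isCorrect_mu1 : IsCorrect (row .mu1) :=
  isCorrect_of_table 1 [⟨1, 2, 3, 1, 13⟩, ⟨1, 3, 4, 4, 1⟩, ⟨1, 4, 5, 1, 12⟩, ⟨2, 3, 5, 2, 1⟩,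
      ⟨3, 4, 6, 1, 12⟩, ⟨5, 2, 6, 1, 13⟩]
    [-82, -60, -38, -16, 6, 50] (-104)
    (fun x => x 0 • ![1, 2, 3, 4, 5, 7]) ![0]
    (torus_fin_one _)

theorem isCorrect_mu3 : IsCorrect (row .mu3) :=
  isCorrect_of_table 1 [⟨1, 2, 3, 2, 1⟩, ⟨1, 3, 4, 1, 6⟩, ⟨1, 4, 5, 1, 6⟩, ⟨1, 5, 6, 2, 1⟩]
    [-40, -8, -4, 0, 4, 8] (-44)
    (fun x => ![x 0, x 1, x 0 + x 1, 2 * x 0 + x 1, 3 * x 0 + x 1, 4 * x 0 + x 1]) ![0, 1]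
    (torus_fin_two _)

theorem isCorrect_mu4 : IsCorrect (row .mu4) :=
  isCorrect_of_table 1 [⟨1, 2, 3, 1, 22⟩, ⟨1, 3, 4, 6, 1⟩, ⟨1, 4, 5, 1, 22⟩, ⟨2, 3, 5, 1, 30⟩,
      ⟨2, 4, 6, 5, 1⟩, ⟨1, 5, 6, 1, 30⟩]
    [-220, -154, -88, -22, 44, 110] (-286)
    (fun x => x 0 • ![1, 2, 3, 4, 5, 6]) ![0]
    (torus_fin_one _)

theorem isCorrect_mu6 : IsCorrect (row .mu6) :=
  isCorrect_of_table 1 [⟨1, 2, 3, 1, 1⟩, ⟨1, 3, 4, 1, 1⟩, ⟨2, 3, 5, 1, 1⟩, ⟨1, 4, 6, 1, 1⟩]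
    [-6, -4, -2, 0, 2, 2] (-8)
    (fun x => ![x 0, x 1, x 0 + x 1, 2 * x 0 + x 1, x 0 + 2 * x 1, 3 * x 0 + x 1]) ![0, 1]
    (torus_fin_two _)

theorem isCorrect_mu12 : IsCorrect (row .mu12) :=
  isCorrect_of_table 1 [⟨1, 2, 4, 1, 3⟩, ⟨1, 4, 5, 1, 3⟩, ⟨1, 5, 6, 1, 2⟩, ⟨2, 4, 6, 1, 2⟩]
    [-16, -10, 0, -4, 2, 8] (-22)
    (fun x => ![x 0, 2 * x 0, x 1, 3 * x 0, 4 * x 0, 5 * x 0]) ![0, 2]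
    (torus_fin_two _)

theorem isCorrect_mu13 : IsCorrect (row .mu13) :=
  isCorrect_of_table 1 [⟨1, 2, 4, 1, 3⟩, ⟨1, 4, 5, 2, 1⟩, ⟨1, 5, 6, 1, 3⟩]
    [-20, -6, 0, -2, 2, 6] (-24)
    (fun x => ![x 0, x 1, x 2, x 0 + x 1, 2 * x 0 + x 1, 3 * x 0 + x 1]) ![0, 1, 2]
    (torus_fin_three _)

theorem isCorrect_mu14 : IsCorrect (row .mu14) :=
  isCorrect_of_table 1 [⟨1, 2, 4, 1, 3⟩, ⟨1, 3, 5, 1, 2⟩, ⟨1, 4, 6, 1, 2⟩, ⟨3, 5, 6, 1, 3⟩]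
    [-14, -6, -10, 2, -2, 10] (-22)
    (fun x => ![x 0, x 1, (x 0 + x 1) / 2, x 0 + x 1, (3 * x 0 + x 1) / 2, 2 * x 0 + x 1]) ![0, 1]
    (torus_fin_two _)

theorem isCorrect_mu17 : IsCorrect (row .mu17) :=
  isCorrect_of_table 1 [⟨1, 2, 4, 2, 1⟩, ⟨1, 4, 5, 1, 3⟩, ⟨2, 4, 6, 1, 3⟩]
    [-14, -14, 0, -4, 6, 6] (-24)
    (fun x => ![x 0, x 1, x 2, x 0 + x 1, 2 * x 0 + x 1, x 0 + 2 * x 1]) ![0, 1, 2]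
    (torus_fin_three _)

theorem isCorrect_mu19 : IsCorrect (row .mu19) :=
  isCorrect_of_table 1 [⟨1, 2, 4, 2, 1⟩, ⟨1, 4, 5, 1, 3⟩, ⟨1, 3, 6, 1, 1⟩, ⟨4, 2, 6, 1, 3⟩]
    [-16, -14, -2, -4, 6, 8] (-26)
    (fun x => ![x 0, x 1, 2 * x 1, x 0 + x 1, 2 * x 0 + x 1, x 0 + 2 * x 1]) ![0, 1]
    (torus_fin_two _)

theorem isCorrect_mu21 : IsCorrect (row .mu21) :=
  isCorrect_of_table 1 [⟨1, 2, 4, 1, 2⟩, ⟨1, 3, 5, 1, 1⟩, ⟨1, 4, 6, 1, 2⟩, ⟨2, 3, 6, 1, 1⟩]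
    [-10, -6, -4, 0, 2, 6] (-16)
    (fun x => ![x 0, x 1, 2 * x 0, x 0 + x 1, 3 * x 0, 2 * x 0 + x 1]) ![0, 1]
    (torus_fin_two _)

theorem isCorrect_mu23 : IsCorrect (row .mu23) :=
  isCorrect_of_table 1 [⟨1, 2, 4, 1, 2⟩, ⟨1, 3, 5, 1, 1⟩, ⟨1, 4, 6, 1, 2⟩]
    [-10, -4, -2, 0, 2, 4] (-14)
    (fun x => ![x 0, x 1, x 2, x 0 + x 1, x 0 + x 2, 2 * x 0 + x 1]) ![0, 1, 2]
    (torus_fin_three _)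

theorem isCorrect_mu24 : IsCorrect (row .mu24) :=
  isCorrect_of_table 1 [⟨1, 2, 4, 1, 1⟩, ⟨1, 3, 5, 1, 1⟩, ⟨2, 3, 6, 1, 1⟩]
    [-4, -4, -4, 2, 2, 2] (-10)
    (fun x => ![x 0, x 1, x 2, x 0 + x 1, x 0 + x 2, x 1 + x 2]) ![0, 1, 2]
    (torus_fin_three _)

theorem isCorrect_mu25 : IsCorrect (row .mu25) :=
  isCorrect_of_table 1 [⟨1, 2, 5, 2, 1⟩, ⟨1, 5, 6, 1, 3⟩, ⟨3, 4, 6, 1, 3⟩]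
    [-14, -8, -6, -6, 2, 12] (-24)
    (fun x => ![x 0, x 1, x 2, 2 * x 0 + x 1 - x 2, x 0 + x 1, 2 * x 0 + x 1]) ![0, 1, 2]
    (torus_fin_three _)

theorem isCorrect_mu26 : IsCorrect (row .mu26) :=
  isCorrect_of_table 1 [⟨1, 2, 5, 1, 1⟩, ⟨1, 5, 6, 1, 1⟩]
    [-4, -2, 0, 0, 0, 2] (-6)
    (fun x => ![x 0, x 1, x 2, x 3, x 0 + x 1, 2 * x 0 + x 1]) ![0, 1, 2, 3]
    (torus_fin_four _)

theorem isCorrect_mu27 : IsCorrect (row .mu27) :=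
  isCorrect_of_table 1 [⟨1, 2, 5, 1, 2⟩, ⟨1, 4, 6, 1, 1⟩, ⟨2, 5, 6, 1, 2⟩]
    [-6, -8, 0, -2, 0, 6] (-14)
    (fun x => ![x 0, x 1, x 2, 2 * x 1, x 0 + x 1, x 0 + 2 * x 1]) ![0, 1, 2]
    (torus_fin_three _)

theorem isCorrect_mu29 : IsCorrect (row .mu29) :=
  isCorrect_of_table 1 [⟨1, 2, 5, 1, 1⟩, ⟨1, 4, 6, 1, 1⟩, ⟨2, 3, 6, 1, 1⟩]
    [-4, -4, -2, -2, 2, 4] (-10)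
    (fun x => ![x 0, x 1, x 2, x 2 - x 0 + x 1, x 0 + x 1, x 1 + x 2]) ![0, 1, 2]
    (torus_fin_three _)

theorem isCorrect_mu30 : IsCorrect (row .mu30) :=
  isCorrect_of_table 1 [⟨1, 2, 5, 1, 1⟩, ⟨3, 4, 6, 1, 1⟩]
    [-2, -2, -2, -2, 2, 2] (-6)
    (fun x => ![x 0, x 1, x 2, x 3, x 0 + x 1, x 2 + x 3]) ![0, 1, 2, 3]
    (torus_fin_four _)

theorem isCorrect_mu31 : IsCorrect (row .mu31) :=
  isCorrect_of_table 1 [⟨1, 2, 5, 1, 1⟩, ⟨1, 3, 6, 1, 1⟩]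
    [-4, -2, -2, 0, 2, 2] (-8)
    (fun x => ![x 0, x 1, x 2, x 3, x 0 + x 1, x 0 + x 2]) ![0, 1, 2, 3]
    (torus_fin_four _)

theorem isCorrect_mu32 : IsCorrect (row .mu32) :=
  isCorrect_of_table 1 [⟨1, 2, 6, 1, 1⟩, ⟨3, 4, 6, 1, 1⟩]
    [-2, -2, -2, -2, 0, 4] (-8)
    (fun x => ![x 0, x 1, x 2, x 0 + x 1 - x 2, x 3, x 0 + x 1]) ![0, 1, 2, 4]
    (torus_fin_four _)

theorem isCorrect_mu33 : IsCorrect (row .mu33) :=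
  isCorrect_of_table 1 [⟨1, 2, 6, 1, 1⟩]
    [-2, -2, 0, 0, 0, 2] (-6)
    (fun x => ![x 0, x 1, x 2, x 3, x 4, x 0 + x 1]) ![0, 1, 2, 3, 4]
    (torus_fin_five _)

/-! ### Lines with fractional radicands, as κ times an integral table -/

theorem isCorrect_mu2 : IsCorrect (row .mu2) :=
  isCorrect_of_table (√(1 / 3)) [⟨1, 2, 3, 1, 3⟩, ⟨1, 3, 4, 2, 1⟩, ⟨1, 4, 5, 1, 3⟩, ⟨3, 4, 6, 1, 3⟩,
      ⟨5, 2, 6, 1, 3⟩]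
    [-20, -12, -8, -4, 0, 12] (-24)
    (fun x => ![x 0, x 1, x 0 + x 1, 2 * x 0 + x 1, 3 * x 0 + x 1, 3 * x 0 + 2 * x 1]) ![0, 1]
    (torus_fin_two _)
    (hω := by
      have h0 : √4 = (2 : ℝ) := by rw [Real.sqrt_eq_iff_mul_self_eq] <;> norm_num
      intro k
      fin_cases k <;> simp [tableForm, rad, h0]
      match_scalars
      field_simp)

theorem isCorrect_mu5 : IsCorrect (row .mu5) :=
  isCorrect_of_table (√(1 / 2)) [⟨1, 2, 3, 1, 14⟩, ⟨1, 3, 4, 1, 15⟩, ⟨1, 4, 5, 3, 2⟩,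
      ⟨2, 3, 6, 1, 15⟩, ⟨1, 5, 6, 2, 2⟩]
    [-110, -58, -32, -6, 20, 46] (-136)
    (fun x => x 0 • ![1, 3, 4, 5, 6, 7]) ![0]
    (torus_fin_one _)
    (hω := by
      have h0 : √14 = √2 * √(7 : ℝ) := by rw [← Real.sqrt_mul] <;> norm_num
      intro k
      fin_cases k <;> simp [tableForm, rad, h0] <;> match_scalars <;> field_simp)

theorem isCorrect_mu9 : IsCorrect (row .mu9) :=
  isCorrect_of_table (√(1 / 4)) [⟨1, 2, 4, 1, 5⟩, ⟨1, 4, 5, 2, 1⟩, ⟨2, 3, 5, -2, 1⟩,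
      ⟨1, 5, 6, 1, 5⟩, ⟨3, 4, 6, 2, 1⟩]
    [-28, -18, -16, -6, 6, 18] (-40)
    (fun x => ![x 0, x 1, 2 * x 0, x 0 + x 1, 2 * x 0 + x 1, 3 * x 0 + x 1]) ![0, 1]
    (torus_fin_two _)
    (hω := by
      have h0 : √4 = (2 : ℝ) := by rw [Real.sqrt_eq_iff_mul_self_eq] <;> norm_num
      intro k
      fin_cases k <;> simp [tableForm, rad, h0] <;> match_scalars <;> field_simp)

theorem isCorrect_mu10 : IsCorrect (row .mu10) :=
  isCorrect_of_table (√(1 / 3)) [⟨1, 2, 4, 1, 3⟩, ⟨1, 4, 5, 1, 5⟩, ⟨1, 5, 6, 1, 3⟩, ⟨2, 3, 6, 1, 3⟩]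
    [-22, -12, -6, -4, 4, 12] (-30)
    (fun x => ![x 0, x 1, 3 * x 0, x 0 + x 1, 2 * x 0 + x 1, 3 * x 0 + x 1]) ![0, 1]
    (torus_fin_two _)
    (hω := by
      intro k
      fin_cases k <;> simp [tableForm, rad]
      match_scalars
      field_simp)

theorem isCorrect_mu22 : IsCorrect (row .mu22) :=
  isCorrect_of_table (√(1 / 4)) [⟨1, 2, 4, 1, 3⟩, ⟨1, 3, 5, 1, 3⟩, ⟨2, 4, 6, 2, 1⟩]
    [-12, -14, -6, -2, 6, 8] (-24)
    (fun x => ![x 0, x 1, x 2, x 0 + x 1, x 0 + x 2, x 0 + 2 * x 1]) ![0, 1, 2]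
    (torus_fin_three _)
    (hω := by
      have h0 : √4 = (2 : ℝ) := by rw [Real.sqrt_eq_iff_mul_self_eq] <;> norm_num
      intro k
      fin_cases k <;> simp [tableForm, rad, h0] <;> match_scalars <;> field_simp)

/-! ### Lines with coinciding weights and a diagonal torus -/

/-- A bracket given by a table, where the off-diagonal entries of symmetric derivations vanish
    at the
pairs `P`, and some element of the torus has no other pairs of equal entries. -/
theorem isCorrect_of_pairs {n r : ℕ} [NeZero n] {ω : Fin n → BilForm n}
    {T : Set (Matrix (Fin n) (Fin n) ℝ)} (κ : ℝ) (L : List Entry)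
    (R : List ℤ) (c : ℤ)
    (F : (Fin r → ℝ) → Fin n → ℝ) (g : Fin r → Fin n)
    (hT : T = {M | ∃ a, M = diag (F a)})
    (P : List (Fin n × Fin n))
    (hP : ∀ M, IsDerivation (ofForms ω) M → M.IsSymm → ∀ p ∈ P, M p.1 p.2 = 0)
    (hκ : κ ≠ 0 := by positivity)
    (hL : IsSolitonTable n L R c := by decide +kernel)
    (hω : ∀ k : Fin n, ω k = κ • tableForm L (k + 1) := by
      intro k; fin_cases k <;> simp [tableForm, rad] <;> module)
    (hg : ∀ a i, F a (g i) = a i := by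
      intro a i; fin_cases i <;> simp)
    (hF : ∀ m, IsWeight L m ↔ m = F fun i => m (g i) := by
      intro m
      simp [IsWeight, funext_iff, Fin.forall_fin_succ]
      try grind)
    (hpairs : ∀ i j, i < j → F (fun i => 10 ^ (i : ℕ)) i = F (fun i => 10 ^ (i : ℕ)) j →
        (i, j) ∈ P := by
      intro i j
      fin_cases i <;> fin_cases j <;> first | (intro _ _; decide; done) | norm_num) :
    IsCorrect ⟨n, ofForms ω, r, T⟩ := by
  refine isCorrect_of_offDiag_eq_zero κ L R c F g (fun i => 10 ^ (i : ℕ)) hT hκ hL hω hg hF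
    fun M hM hc => ?_
  have hz : ∀ i j, F (fun i => 10 ^ (i : ℕ)) i ≠ F (fun i => 10 ^ (i : ℕ)) j → M i j = 0 :=
    fun i j hij => by
      by_contra h0
      exact hij (mul_left_cancel₀ h0 ((hc i j).trans (mul_comm _ _))).symm
  have h := hP M hM.2 hM.1
  intro i j hij
  by_cases hw : F (fun i => 10 ^ (i : ℕ)) i = F (fun i => 10 ^ (i : ℕ)) j
  · rcases lt_or_gt_of_ne hij with hlt | hlt
    · exact h _ (hpairs i j hlt hw)
    · rw [← hM.1.apply]; exact h _ (hpairs j i hlt hw.symm)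
  · exact hz i j hw

theorem IsDerivation.ofForms_eq {n : ℕ} {ω : Fin n → BilForm n} {M : Matrix (Fin n) (Fin n) ℝ}
    (h : IsDerivation (ofForms ω) M) (i j k : Fin n) :
    ∑ l, M k l * ω l (Pi.single i 1) (Pi.single j 1) =
      ω k (fun l => M l i) (Pi.single j 1) + ω k (Pi.single i 1) (fun l => M l j) := by
  have := congrFun (h (Pi.single i 1) (Pi.single j 1)) k
  rw [mulVec_single_one, mulVec_single_one] at this
  exact this

theorem isCorrect_mu8 : IsCorrect (row .mu8) :=
  isCorrect_of_pairs 1 [⟨1, 2, 3, 2, 1⟩, ⟨1, 3, 4, 1, 5⟩, ⟨2, 3, 5, 1, 5⟩, ⟨1, 4, 6, 2, 1⟩,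
      ⟨2, 5, 6, 2, 1⟩]
    [-26, -26, -12, 2, 2, 16] (-40)
    (fun x => x 0 • ![1, 1, 2, 3, 3, 4]) ![0]
    (torus_fin_one _) [(0, 1), (3, 4)] (by
      intro M hM hs
      -- With indices from 1, these read M_54 = M_21 and M_21 + M_45 = 0, so by symmetry both
      -- entries vanish.
      have h0 := hM.ofForms_eq 0 2 4
      have h1 := hM.ofForms_eq 0 4 5
      simp [e, Fin.sum_univ_succ, -Fin.ofNat_eq_cast] at h0 h1
      simp
      grind [hs.apply 0 1, hs.apply 3 4])

theorem isCorrect_mu11 : IsCorrect (row .mu11) :=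
  -- 56 is the common denominator of the squared coefficients.
  isCorrect_of_pairs (√(1 / 56)) [⟨1, 2, 3, -5, 1⟩, ⟨1, 2, 4, 2, 6⟩, ⟨1, 4, 5, 1, 10⟩,
      ⟨1, 3, 5, -2, 15⟩, ⟨1, 5, 6, 1, 42⟩, ⟨2, 4, 6, 7, 1⟩]
    [-322, -196, -70, -70, 56, 182] (-448)
    (fun x => x 0 • ![1, 2, 3, 3, 4, 5]) ![0]
    (torus_fin_one _) [(2, 3)] (by
      intro M hM hs
      -- The X_6-component of the identity for [X_2, X_3] = 0 leaves only the multiple of M_43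
      -- coming from [X_2, X_4].
      have h0 := hM.ofForms_eq 1 2 5
      simp [e, Fin.sum_univ_succ, -Fin.ofNat_eq_cast] at h0
      simp
      grind [hs.apply 2 3])
    (hω := by
      have h0 : √25 = (5 : ℝ) := by rw [Real.sqrt_eq_iff_mul_self_eq] <;> norm_num
      have h1 : √4 = (2 : ℝ) := by rw [Real.sqrt_eq_iff_mul_self_eq] <;> norm_num
      have h2 : √8 = 2 * √(2 : ℝ) := by rw [show (8 : ℝ) = 2 ^ 2 * 2 by norm_num,
          Real.sqrt_mul, Real.sqrt_sq] <;> norm_num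
      have h3 : √28 = 2 * √(7 : ℝ) := by rw [show (28 : ℝ) = 2 ^ 2 * 7 by norm_num,
          Real.sqrt_mul, Real.sqrt_sq] <;> norm_num
      have h4 : √56 = 2 * (√2 * √(7 : ℝ)) := by rw [show (56 : ℝ) = 2 ^ 2 * (2 * 7) by
          norm_num, Real.sqrt_mul, Real.sqrt_sq, Real.sqrt_mul] <;> norm_num
      have h5 : √6 = √2 * √(3 : ℝ) := by rw [← Real.sqrt_mul] <;> norm_num
      have h6 : √10 = √2 * √(5 : ℝ) := by rw [← Real.sqrt_mul] <;> norm_num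
      have h7 : √14 = √2 * √(7 : ℝ) := by rw [← Real.sqrt_mul] <;> norm_num
      have h8 : √42 = √2 * √(21 : ℝ) := by rw [← Real.sqrt_mul] <;> norm_num
      have h9 : √21 = √3 * √(7 : ℝ) := by rw [← Real.sqrt_mul] <;> norm_num
      intro k
      fin_cases k <;> simp [tableForm, rad, h0, h1, h2, h3, h4, h5, h6, h7, h8, h9] <;>
          match_scalars <;> field_simp <;> norm_num)

theorem isCorrect_mu16 : IsCorrect (row .mu16) :=
  isCorrect_of_pairs 1 [⟨1, 2, 4, 1, 1⟩, ⟨2, 3, 5, 1, 1⟩, ⟨1, 4, 6, 1, 1⟩, ⟨3, 5, 6, -1, 1⟩]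
    [-4, -4, -4, 0, 0, 4] (-8)
    (fun x => ![x 0, x 1, x 0, x 0 + x 1, x 0 + x 1, 2 * x 0 + x 1]) ![0, 1]
    (torus_fin_two _) [(0, 2), (3, 4)] (by
      intro M hM hs
      have h0 := hM.ofForms_eq 0 1 4
      have h1 := hM.ofForms_eq 0 4 5
      simp [e, Fin.sum_univ_succ, -Fin.ofNat_eq_cast] at h0 h1
      simp
      grind [hs.apply 0 2, hs.apply 3 4])

theorem isCorrect_mu18 : IsCorrect (row .mu18) :=
  isCorrect_of_pairs (√(1 / 2)) [⟨1, 2, 4, 2, 1⟩, ⟨1, 3, 5, 1, 1⟩, ⟨4, 2, 5, 1, 3⟩, ⟨1, 4, 6, 1, 3⟩,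
      ⟨2, 3, 6, 1, 1⟩]
    [-16, -16, -4, -4, 8, 8] (-28)
    (fun x => x 0 • ![1, 1, 2, 2, 3, 3]) ![0]
    (torus_fin_one _) [(0, 1), (2, 3), (4, 5)] (by
      intro M hM hs
      -- No bracket has an X_3-component, so M_34 = 0. The other two equations then give M_65 = M_21
      -- and M_56 = −M_21.
      have h0 := hM.ofForms_eq 0 1 2
      have h1 := hM.ofForms_eq 0 2 5
      have h2 := hM.ofForms_eq 0 3 4
      simp [e, Fin.sum_univ_succ, -Fin.ofNat_eq_cast] at h0 h1 h2
      simp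
      grind [hs.apply 0 1, hs.apply 2 3, hs.apply 4 5])
    (hω := by
      intro k
      fin_cases k <;> simp [tableForm, rad] <;> match_scalars <;> field_simp <;> norm_num)

theorem isCorrect_mu20 : IsCorrect (row .mu20) :=
  isCorrect_of_pairs 1 [⟨1, 2, 3, -1, 1⟩, ⟨1, 2, 4, 1, 3⟩, ⟨1, 4, 5, 2, 1⟩, ⟨2, 4, 6, 1, 1⟩,
      ⟨2, 3, 6, -1, 3⟩]
    [-16, -16, -4, -4, 8, 8] (-28)
    (fun x => ![x 0, x 1, x 0 + x 1, x 0 + x 1, 2 * x 0 + x 1, x 0 + 2 * x 1]) ![0, 1]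
    (torus_fin_two _) [(2, 3)] (by
      intro M hM hs
      have h0 := hM.ofForms_eq 0 2 4
      simp [e, Fin.sum_univ_succ, -Fin.ofNat_eq_cast] at h0
      simp
      grind [hs.apply 2 3])

theorem isCorrect_mu28 : IsCorrect (row .mu28) :=
  isCorrect_of_pairs 1 [⟨1, 3, 5, 1, 1⟩, ⟨4, 2, 5, 1, 1⟩, ⟨1, 4, 6, 1, 1⟩, ⟨2, 3, 6, 1, 1⟩]
    [-4, -4, -4, -4, 4, 4] (-12)
    (fun x => ![x 0, x 0, x 1, x 1, x 0 + x 1, x 0 + x 1]) ![0, 2]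
    (torus_fin_two _) [(0, 1), (2, 3), (4, 5)] (by
      intro M hM hs
      -- With x = M_12, y = M_34, z = M_56 the three equations are z = x + y, z = y − x and z = x −
      -- y, so all three vanish.
      have h0 := hM.ofForms_eq 0 2 5
      have h1 := hM.ofForms_eq 0 3 4
      have h2 := hM.ofForms_eq 1 2 4
      simp [e, Fin.sum_univ_succ, -Fin.ofNat_eq_cast] at h0 h1 h2
      simp
      grind [hs.apply 0 1, hs.apply 2 3, hs.apply 4 5])

/-! ### Lines whose torus is not diagonal -/

/-- A bracket given by a table, and a torus spanned by diagonal matrices and a further matrix `B`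
with vanishing diagonal. -/
theorem isCorrect_of_diag_add {n r : ℕ} [NeZero n] {ω : Fin n → BilForm n}
    {T : Set (Matrix (Fin n) (Fin n) ℝ)} (L : List Entry) (R : List ℤ) (c : ℤ)
    (F : (Fin r → ℝ) → Fin n → ℝ) (g : Fin r → Fin n) (B : Matrix (Fin n) (Fin n) ℝ)
    (P : List (Fin n × Fin n))
    (hT : T = {M | ∃ (a : Fin r → ℝ) (t : ℝ), M = diag (F a) + t • B})
    (hB : IsDerivation (ofForms ω) B) (hB0 : B ≠ 0)
    (hBs : ∀ i j, B j i = B i j) (hBd : ∀ i, B i i = 0)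
    (hBc : ∀ a i j, B i j ≠ 0 → F a i = F a j)
    (hP : ∀ M, IsDerivation (ofForms ω) M → M.IsSymm →
      ∃ t : ℝ, ∀ p ∈ P, M p.1 p.2 = t * B p.1 p.2)
    (hL : IsSolitonTable n L R c := by decide +kernel)
    (hω : ∀ k : Fin n, ω k = (1 : ℝ) • tableForm L (k + 1) := by
      intro k; fin_cases k <;> simp [tableForm, rad] <;> module)
    (hg : ∀ a i, F a (g i) = a i := by
      intro a i; fin_cases i <;> simp)
    (hF : ∀ m, IsWeight L m ↔ m = F fun i => m (g i) := by
      intro m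
      simp [IsWeight, funext_iff, Fin.forall_fin_succ]
      try grind)
    (hpairs : ∀ i j, i < j → F (fun i => 10 ^ (i : ℕ)) i = F (fun i => 10 ^ (i : ℕ)) j →
        (i, j) ∈ P := by
      intro i j
      fin_cases i <;> fin_cases j <;> first | (intro _ _; decide; done) | norm_num) :
    IsCorrect ⟨n, ofForms ω, r + 1, T⟩ := by
  have htab := hasTable_ofForms hL.1 hω
  have hFw : ∀ a, IsWeight L (F a) := fun a => (hF _).2 (by rw [funext (hg a)])
  have hder := htab.isDerivation_diag_iff one_ne_zero hL
  set W := (weightSpace n L).map (diagonalLinearMap (Fin n) ℝ ℝ) with hW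
  have hBcomm : ∀ M ∈ W, Commute M B := by
    rintro _ ⟨m, hm, rfl⟩
    refine Matrix.ext fun i j => ?_
    change (diag m * B) i j = (B * diag m) i j
    rw [diagonal_mul, mul_diagonal]
    by_cases h : B i j = 0
    · rw [h, mul_zero, zero_mul]
    · have := hBc (fun i => m (g i)) i j h
      rw [← (hF m).1 hm] at this
      rw [this, mul_comm]
  have hWcomm : ∀ M ∈ W, ∀ N ∈ W, Commute M N := by
    rintro _ ⟨m, hm, rfl⟩ _ ⟨m', hm', rfl⟩
    exact commute_diagonal m m'
  have hmem : ∀ M, M ∈ W ⊔ Submodule.span ℝ {B} ↔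
      ∃ (a : Fin r → ℝ) (t : ℝ), M = diag (F a) + t • B := fun M => by
    rw [Submodule.mem_sup]
    constructor
    · rintro ⟨_, ⟨m, hm, rfl⟩, _, hN, rfl⟩
      obtain ⟨t, rfl⟩ := Submodule.mem_span_singleton.1 hN
      exact ⟨_, t, by rw [← (hF m).1 hm]; rfl⟩
    · rintro ⟨a, t, rfl⟩
      exact ⟨_, ⟨F a, hFw a, rfl⟩, _, Submodule.mem_span_singleton.2 ⟨t, rfl⟩, rfl⟩
  refine isCorrect_of_centralizer (htab.isNilsoliton hL) (W ⊔ Submodule.span ℝ {B}) ?_ ⟨?_, ?_⟩ ?_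
    -- A diagonal element, without `B`-component, already has a small enough centralizer.
    ((hmem _).2 ⟨fun i => 10 ^ (i : ℕ), 0, rfl⟩) ?_
  · ext M
    rw [hT]
    exact hmem M
  · refine sup_le ?_ ((Submodule.span_singleton_le_iff_mem _ _).2 ⟨Matrix.ext fun i j => hBs i
      j, hB⟩)
    rintro _ ⟨m, hm, rfl⟩
    exact ⟨isSymm_diagonal m, (hder m).2 hm⟩
  · intro M hM N hN
    obtain ⟨M, hMW, _, hM', rfl⟩ := Submodule.mem_sup.1 hM
    obtain ⟨N, hNW, _, hN', rfl⟩ := Submodule.mem_sup.1 hN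
    obtain ⟨s, rfl⟩ := Submodule.mem_span_singleton.1 hM'
    obtain ⟨t, rfl⟩ := Submodule.mem_span_singleton.1 hN'
    exact sub_eq_zero.2 (((hWcomm M hMW N hNW).add_right ((hBcomm M hMW).smul_right t)).add_left
      (((hBcomm N hNW).symm.add_right ((Commute.refl B).smul_right t)).smul_left s)).eq
  · have hdisj : W ⊓ Submodule.span ℝ {B} = ⊥ := by
      refine (Submodule.eq_bot_iff _).2 ?_
      rintro _ ⟨⟨m, hm, rfl⟩, hM⟩
      obtain ⟨t, ht⟩ := Submodule.mem_span_singleton.1 hM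
      have : m = 0 := funext fun i => by
        have h := congrFun (congrFun ht i) i
        simpa [hBd] using h.symm
      rw [this, map_zero]
    have := Submodule.finrank_sup_add_finrank_inf_eq W (Submodule.span ℝ {B})
    rwa [hdisj, finrank_bot, add_zero, finrank_map_weightSpace hg hF, finrank_span_singleton hB0]
      at this
  · intro M hM hc
    -- Subtracting the multiple of `B` that agrees with `M` at the pairs of equal weights leaves a
    -- diagonal derivation.
    obtain ⟨t, ht⟩ := hP M hM.2 hM.1
    have hD : M - t • B ∈ symDer (ofForms ω) :=
      sub_mem hM (Submodule.smul_mem _ t ⟨Matrix.ext fun i j => hBs i j, hB⟩)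
    have hlt : ∀ i j, i < j → (M - t • B) i j = 0 := fun i j hij => by
      by_cases hw : F (fun i => 10 ^ (i : ℕ)) i = F (fun i => 10 ^ (i : ℕ)) j
      · exact sub_eq_zero.2 (ht _ (hpairs i j hij hw))
      · have hB' : B i j = 0 := by
          by_contra h
          exact hw (hBc _ i j h)
        have h1 := congrFun (congrFun hc.eq i) j
        simp only [zero_smul, add_zero, mul_diagonal, diagonal_mul] at h1
        have hM' : M i j = 0 := by
          by_contra h0
          exact hw (mul_left_cancel₀ h0 (h1.trans (mul_comm _ _))).symm
        simp [hB', hM']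
    have hdiag : M - t • B = diag fun i => (M - t • B) i i := by
      refine ((isDiag_iff_diagonal_diag _).1 fun i j hij => ?_).symm
      rcases lt_or_gt_of_ne hij with h | h
      · exact hlt i j h
      · rw [← hD.1.apply]; exact hlt j i h
    rw [← sub_add_cancel M (t • B)]
    refine Submodule.add_mem_sup ?_ (Submodule.mem_span_singleton.2 ⟨t, rfl⟩)
    rw [hdiag]
    exact ⟨_, (hder _).1 (hdiag ▸ hD.2), rfl⟩

theorem isCorrect_mu7 : IsCorrect (row .mu7) := by
  refine isCorrect_of_diag_add [⟨1, 2, 3, 2, 1⟩, ⟨1, 3, 4, 1, 5⟩, ⟨2, 3, 5, 1, 5⟩, ⟨1, 4, 6, 2, 1⟩,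
    ⟨2, 5, 6, -2, 1⟩] [-26, -26, -12, 2, 2, 16] (-40)
    (fun x => x 0 • ![1, 1, 2, 3, 3, 4]) ![0]
    !![0, 1, 0, 0, 0, 0; 1, 0, 0, 0, 0, 0; 0, 0, 0, 0, 0, 0;
      0, 0, 0, 0, 1, 0; 0, 0, 0, 1, 0, 0; 0, 0, 0, 0, 0, 0] [(0, 1), (3, 4)] ?_ ?_ ?_ ?_ ?_ ?_ ?_
  · refine (torus_fin_two _).trans (Set.ext fun M => ?_)
    have key : ∀ a b : ℝ, !![a, b, 0, 0, 0, 0; b, a, 0, 0, 0, 0; 0, 0, 2 * a, 0, 0, 0;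
        0, 0, 0, 3 * a, b, 0; 0, 0, 0, b, 3 * a, 0; 0, 0, 0, 0, 0, 4 * a] =
        diag (a • ![1, 1, 2, 3, 3, 4]) + b • !![0, 1, 0, 0, 0, 0; 1, 0, 0, 0, 0, 0;
        0, 0, 0, 0, 0, 0; 0, 0, 0, 0, 1, 0; 0, 0, 0, 1, 0, 0; 0, 0, 0, 0, 0, 0] := fun a b => by
      ext i j
      fin_cases i <;> fin_cases j <;> simp [mul_comm]
    exact ⟨fun ⟨x, h⟩ => ⟨![x 0], x 1, h.trans (key _ _)⟩,
      fun ⟨x, t, h⟩ => ⟨![x 0, t], h.trans (key _ _).symm⟩⟩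
  · intro x y
    ext k
    fin_cases k <;>
      simp [ofForms, e, mulVec, dotProduct, Fin.sum_univ_succ, -Fin.ofNat_eq_cast] <;> ring
  · exact fun h => one_ne_zero (congrFun (congrFun h 0) 1)
  · intro i j
    fin_cases i <;> fin_cases j <;> rfl
  · intro i
    fin_cases i <;> rfl
  · intro a i j
    fin_cases i <;> fin_cases j <;> simp
  · intro M hM hs
    -- This gives M_54 = M_21, with indices from 1. The two entries of `mu8` are killed by a second
    -- equation with the opposite sign; here the sign in the last bracket makes that equation repeat
    -- the first, so one parameter survives.
    have h0 := hM.ofForms_eq 0 2 4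
    simp [e, Fin.sum_univ_succ, -Fin.ofNat_eq_cast] at h0
    refine ⟨M 0 1, ?_⟩
    simp
    grind [hs.apply 0 1, hs.apply 3 4]

theorem isCorrect_mu15 : IsCorrect (row .mu15) := by
  refine isCorrect_of_diag_add [⟨1, 2, 4, 1, 1⟩, ⟨2, 3, 5, 1, 1⟩, ⟨1, 4, 6, 1, 1⟩,
    ⟨3, 5, 6, 1, 1⟩] [-4, -4, -4, 0, 0, 4] (-8)
    (fun x => ![x 0, x 1, x 0, x 0 + x 1, x 0 + x 1, 2 * x 0 + x 1]) ![0, 1]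
    !![0, 0, 1, 0, 0, 0; 0, 0, 0, 0, 0, 0; 1, 0, 0, 0, 0, 0;
      0, 0, 0, 0, -1, 0; 0, 0, 0, -1, 0, 0; 0, 0, 0, 0, 0, 0] [(0, 2), (3, 4)] ?_ ?_ ?_ ?_ ?_ ?_ ?_
  · refine (torus_fin_three _).trans (Set.ext fun M => ?_)
    have key : ∀ a b c : ℝ, !![a, 0, c, 0, 0, 0; 0, b, 0, 0, 0, 0; c, 0, a, 0, 0, 0;
        0, 0, 0, a + b, -c, 0; 0, 0, 0, -c, a + b, 0; 0, 0, 0, 0, 0, 2 * a + b] =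
        diag ![a, b, a, a + b, a + b, 2 * a + b] + c • !![0, 0, 1, 0, 0, 0; 0, 0, 0, 0, 0, 0;
        1, 0, 0, 0, 0, 0; 0, 0, 0, 0, -1, 0; 0, 0, 0, -1, 0, 0; 0, 0, 0, 0, 0, 0] :=
      fun a b c => by
        ext i j
        fin_cases i <;> fin_cases j <;> simp
    exact ⟨fun ⟨x, h⟩ => ⟨![x 0, x 1], x 2, h.trans (key _ _ _)⟩,
      fun ⟨x, t, h⟩ => ⟨![x 0, x 1, t], h.trans (key _ _ _).symm⟩⟩
  · intro x y
    ext k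
    fin_cases k <;>
      simp [ofForms, e, mulVec, dotProduct, Fin.sum_univ_succ, -Fin.ofNat_eq_cast] <;> ring
  · exact fun h => one_ne_zero (congrFun (congrFun h 0) 2)
  · intro i j
    fin_cases i <;> fin_cases j <;> rfl
  · intro i
    fin_cases i <;> rfl
  · intro a i j
    fin_cases i <;> fin_cases j <;> simp
  · intro M hM hs
    -- This gives M_54 = −M_31, with indices from 1, whence the sign of the lower block of `B`.
    have h0 := hM.ofForms_eq 0 1 4
    simp [e, Fin.sum_univ_succ, -Fin.ofNat_eq_cast] at h0
    refine ⟨M 0 2, ?_⟩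
    simp
    grind [hs.apply 0 2, hs.apply 3 4]

/-! ### Abelian lines and the complete list -/

theorem isCorrect_abelianRow {n : ℕ} [NeZero n] (hL : IsSolitonTable n [] [] 0) :
    IsCorrect (abelianRow n) := by
  have h0 : (0 : Bracket n) = ofForms 0 := by
    ext; simp [ofForms]
  rw [abelianRow, h0]
  refine isCorrect_of_offDiag_eq_zero 1 [] [] 0 (fun x : Fin n → ℝ => x) id
    (fun i => 10 ^ (i : ℕ)) rfl one_ne_zero hL (fun k => by simp [tableForm]) (fun _ _ => rfl)
    (fun m => ⟨fun _ => rfl, fun _ => by simp [IsWeight]⟩) fun M _ hc i j hij => ?_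
  by_contra h
  have h1 := mul_left_cancel₀ h ((hc i j).trans (mul_comm _ _))
  exact hij (Fin.ext (pow_right_injective₀ (by norm_num) (by norm_num) h1)).symm

theorem isCorrect_row : ∀ N : Name, IsCorrect (row N)
  | .R1 => isCorrect_abelianRow (n := 1) (by decide +kernel)
  | .R2 => isCorrect_abelianRow (n := 2) (by decide +kernel)
  | .R3 => isCorrect_abelianRow (n := 3) (by decide +kernel)
  | .heis => isCorrect_heis
  | .eta1 => isCorrect_eta1
  | .eta2 => isCorrect_eta2
  | .eta3 => isCorrect_abelianRow (n := 4) (by decide +kernel)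
  | .lam1 => isCorrect_lam1
  | .lam2 => isCorrect_lam2
  | .lam3 => isCorrect_lam3
  | .lam4 => isCorrect_lam4
  | .lam5 => isCorrect_lam5
  | .lam6 => isCorrect_lam6
  | .lam7 => isCorrect_lam7
  | .lam8 => isCorrect_lam8
  | .lam9 => isCorrect_abelianRow (n := 5) (by decide +kernel)
  | .mu1 => isCorrect_mu1
  | .mu2 => isCorrect_mu2
  | .mu3 => isCorrect_mu3
  | .mu4 => isCorrect_mu4
  | .mu5 => isCorrect_mu5
  | .mu6 => isCorrect_mu6
  | .mu7 => isCorrect_mu7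
  | .mu8 => isCorrect_mu8
  | .mu9 => isCorrect_mu9
  | .mu10 => isCorrect_mu10
  | .mu11 => isCorrect_mu11
  | .mu12 => isCorrect_mu12
  | .mu13 => isCorrect_mu13
  | .mu14 => isCorrect_mu14
  | .mu15 => isCorrect_mu15
  | .mu16 => isCorrect_mu16
  | .mu17 => isCorrect_mu17
  | .mu18 => isCorrect_mu18
  | .mu19 => isCorrect_mu19
  | .mu20 => isCorrect_mu20
  | .mu21 => isCorrect_mu21
  | .mu22 => isCorrect_mu22
  | .mu23 => isCorrect_mu23
  | .mu24 => isCorrect_mu24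
  | .mu25 => isCorrect_mu25
  | .mu26 => isCorrect_mu26
  | .mu27 => isCorrect_mu27
  | .mu28 => isCorrect_mu28
  | .mu29 => isCorrect_mu29
  | .mu30 => isCorrect_mu30
  | .mu31 => isCorrect_mu31
  | .mu32 => isCorrect_mu32
  | .mu33 => isCorrect_mu33
  | .mu34 => isCorrect_abelianRow (n := 6) (by decide +kernel)

end Solsoliton

theorem mainTheorem2 :
    (∀ N : Name,
      IsNilsoliton (row N).bracket ∧
      (∃ 𝔞 : Submodule ℝ (Matrix (Fin (row N).dim) (Fin (row N).dim) ℝ),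
        (𝔞 : Set (Matrix (Fin (row N).dim) (Fin (row N).dim) ℝ)) = (row N).torus ∧
        IsMaximalAbelian (row N).bracket 𝔞) ∧
      (∀ 𝔞 : Submodule ℝ (Matrix (Fin (row N).dim) (Fin (row N).dim) ℝ),
        IsMaximalAbelian (row N).bracket 𝔞 →
          Module.finrank ℝ 𝔞 = Solsoliton.rank (row N).bracket) ∧
      Solsoliton.rank (row N).bracket = (row N).rankValue) ∧
    (∀ N : Name, Solsoliton.rank (row N).bracket = 1 ↔
      N = .R1 ∨ N = .lam2 ∨ N = .mu1 ∨ N = .mu4 ∨ N = .mu5 ∨ N = .mu8 ∨ N = .mu11 ∨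
        N = .mu18) := by
  refine ⟨isCorrect_row, fun N => ?_⟩
  rw [(isCorrect_row N).2.2.2]
  cases N <;> simp [row, abelianRow]
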